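/- For real random variables $V,Z$ let $$T(V,Z)=\frac{\int \mathrm{Var}\big(\mathbb P(V\ge t\mid Z)\big)\,d\mu_V(t)}{\int \mathrm{Var}\big(\mathbf 1_{\{V\ge t\}}\big)\,d\mu_V(t)},$$ where $\mu_V$ is the law of $V$, be the Azadkia–Chatterjee coefficient. For $\mathbf v,\mathbf z\in\mathbb R^n$ let $$T_n(\mathbf v,\mathbf z)=\frac{\sum_{i=1}^n\big(n\min\{R_i,R_{M(i)}\}-L_i^2\big)}{\sum_{i=1}^n L_i(n-L_i)}$$ be its sample version, where $R_i=\#\{j: v_j\le v_i\}$, $L_i=\#\{j: v_j\ge v_i\}$ and $M(i)\ne i$ is the index of a nearest neighbour of $z_i$ among the $z_j$, $j\neq i$ (ties may be broken by any measurable rule, in particular uniformly at random; $T_n:=0$ if the denominator vanishes). Let $X$ be a bounded real random variable with a continuous distribution (that is, $\mathbb P(X=a)=0$ for every $a\in\mathbb R$). Let $\mathcal E$ be independent of $X$, centered, and uniformly distributed on a set of $k>1$ distinct real numbers. Let $Y=X\beta+\mathcal E$ with $\beta\ne0$. Let $(x_i,y_i)_{i\ge1}$ be i.i.d. copies of $(X,Y)$.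 For $n\ge1$ let $\hat\beta_n=\sum_{i\le n}x_iy_i\big/\sum_{i\le n}x_i^2$ be the least squares coefficient of the linear regression of $y_1,\dots,y_n$ on $x_1,\dots,x_n$ (without intercept), and let $\hat\epsilon_i^{(n)}=y_i-x_i\hat\beta_n$ be the estimated residuals and $\epsilon_i=y_i-x_i\beta$ the errors. Put $\hat{\boldsymbol\epsilon}=(\hat\epsilon^{(n)}_1,\dots,\hat\epsilon^{(n)}_n)$ and $\mathbf x=(x_1,\dots,x_n)$. Then: 1. $T(\mathcal E,X)=0$; 2. for every $i$, $\hat\epsilon_i^{(n)}\to\epsilon_i$ in probability as $n\to\infty$; 3. $T_n(\hat{\boldsymbol\epsilon},\mathbf x)$ is integrable for every $n$, and $$\mathbb E\big[T_n(\hat{\boldsymbol\epsilon},\mathbf x)\big]\longrightarrow \frac1{k^2}>0\qquad(n\to\infty).$$ -/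

import Mathlib

open MeasureTheory ProbabilityTheory Filter Topology

noncomputable section

/-- The population Azadkia–Chatterjee coefficient of `Y` on `Z` (without conditioning variables):
`T(Y, Z) = ∫ Var(P(Y ≥ t | Z)) dμ_Y(t) / ∫ Var(1{Y ≥ t}) dμ_Y(t)`, where `μ_Y` is the law of `Y`. -/
def acT {Ω : Type*} [MeasurableSpace Ω] (μ : Measure Ω) (Y Z : Ω → ℝ) : ℝ :=
  (∫ t, Var[μ[{ω | t ≤ Y ω}.indicator (fun _ => (1 : ℝ)) |
      MeasurableSpace.comap Z inferInstance]; μ] ∂(μ.map Y)) /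
    ∫ t, Var[{ω | t ≤ Y ω}.indicator (fun _ => (1 : ℝ)); μ] ∂(μ.map Y)

/-- `R_i`, the number of `j` with `y_j ≤ y_i`. -/
def acR {n : ℕ} (y : Fin n → ℝ) (i : Fin n) : ℕ :=
  (Finset.univ.filter fun j => y j ≤ y i).card

/-- `L_i`, the number of `j` with `y_j ≥ y_i`. -/
def acL {n : ℕ} (y : Fin n → ℝ) (i : Fin n) : ℕ :=
  (Finset.univ.filter fun j => y i ≤ y j).card

/-- `M` sends every index `i` to the index of a nearest neighbour of `z_i` among the `z_j`, `j ≠ i`.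
Ties may be broken in any way. -/
def IsNearestNeighbourMap {n : ℕ} (z : Fin n → ℝ) (M : Fin n → Fin n) : Prop :=
  ∀ i, M i ≠ i ∧ ∀ j, j ≠ i → |z (M i) - z i| ≤ |z j - z i|

/-- The sample Azadkia–Chatterjee statistic `T_n(y, z)`. It depends on `z` only through the nearest
neighbour map `M` of `z`:
`T_n = ∑ i, (n * min(R_i, R_{M(i)}) - L_i ^ 2) / ∑ i, L_i * (n - L_i)`. -/
def acTn {n : ℕ} (y : Fin n → ℝ) (M : Fin n → Fin n) : ℝ :=
  (∑ i, ((n : ℝ) * min (acR y i : ℝ) (acR y (M i) : ℝ) - (acL y i : ℝ) ^ 2)) /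
    ∑ i, (acL y i : ℝ) * ((n : ℝ) - (acL y i : ℝ))

/-- The least squares coefficient `xᵀy / xᵀx` of the linear regression of `y_0, …, y_{n-1}` on
`x_0, …, x_{n-1}`. -/
def lsSlope (n : ℕ) (x y : ℕ → ℝ) : ℝ :=
  (∑ i ∈ Finset.range n, x i * y i) / ∑ i ∈ Finset.range n, x i ^ 2

/-- `lsSlope` minimises the sum of squared residuals. -/
theorem lsSlope_isLeast (n : ℕ) (x y : ℕ → ℝ) (b : ℝ) :
    ∑ i ∈ Finset.range n, (y i - x i * lsSlope n x y) ^ 2 ≤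
      ∑ i ∈ Finset.range n, (y i - x i * b) ^ 2 := by
  have key : ∀ c : ℝ, ∑ i ∈ Finset.range n, (y i - x i * c) ^ 2 =
      ∑ i ∈ Finset.range n, y i ^ 2 - 2 * c * ∑ i ∈ Finset.range n, x i * y i +
        c ^ 2 * ∑ i ∈ Finset.range n, x i ^ 2 := by
    intro c
    rw [Finset.mul_sum, Finset.mul_sum, ← Finset.sum_sub_distrib, ← Finset.sum_add_distrib]
    exact Finset.sum_congr rfl fun i _ => by ring
  rw [key, key]
  unfold lsSlope
  set A := ∑ i ∈ Finset.range n, x i * y i with hA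
  set B := ∑ i ∈ Finset.range n, x i ^ 2 with hB
  have hB0 : 0 ≤ B := Finset.sum_nonneg fun i _ => sq_nonneg _
  rcases hB0.eq_or_lt with h | h
  · have hx : ∀ i ∈ Finset.range n, x i = 0 := by
      intro i hi
      have := (Finset.sum_eq_zero_iff_of_nonneg (fun i _ => sq_nonneg (x i))).1 h.symm i hi
      exact pow_eq_zero_iff (two_ne_zero) |>.1 this
    have hA0 : A = 0 := Finset.sum_eq_zero fun i hi => by rw [hx i hi, zero_mul]
    rw [← h, hA0]
    simp
  · have : 0 ≤ B * (b - A / B) ^ 2 := by positivity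
    have e : B * (b - A / B) ^ 2 = (-2 * b * A + b ^ 2 * B) - (-2 * (A / B) * A + (A / B) ^ 2 * B) := by
      field_simp
      ring
    linarith

/-- The estimated residual `y_i - x_i β̂_n`, where `β̂_n` is fitted on the first `n` observations. -/
def lsResidual (n : ℕ) (x y : ℕ → ℝ) (i : ℕ) : ℝ :=
  y i - x i * lsSlope n x y

end

/-! Write δ for β minus the least squares slope, so that the i-th residual is ε_i + x_i δ. By the
strong law δ → 0 almost surely, and almost surely δ ≠ 0 for all large n. The errors lie in a finite
set and the x_i are bounded, so once |δ| is small against the gaps of that set the residuals are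
ordered lexicographically by (ε_i, σ x_i), where σ is the sign of δ (`eventually_residual_le_iff`).
However small δ is, it breaks every tie among the errors, and breaks it by x; the statistic sees
only ranks, so this dependence on x survives in the limit.

Without ties the denominator is deterministic and the statistic is affine in ∑ min(R_i, R_{M(i)})
(`acTn_of_injective`). No sample point lies strictly between x_i and its nearest neighbour, so up to
O(n) this sum is `lexCount`, the number of pairs (i, j) with (ε_j, σ x_j) lexicographically at most
(min(ε_i, ε_{M(i)}), σ x_i). For three independent uniform errors its density is v = P(ε_j < min) +
P(ε_j = min)/2 = (2k² + 1)/(6k²), and the affine map sends v to 6v - 2 = 1/k².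

The density is reached in L¹ at rate n^(-1/2): almost surely M is a function of x, which is
independent of the errors, so after centring the errors everything reduces to second moments of sums
with orthogonal terms (`exists_integrable_abs_trilinear_sub_le`). Since σ depends on the errors, the
estimate is made for each fixed sign and the two bounds are added. The uniform bound `abs_acTn_le`
turns this into convergence of expectations. -/

/-! ### Rank sums, and boundedness of the statistic. -/

/-- Summing a function of the reversed rank over a finite set with an injective score. -/
theorem sum_card_filter_le {ι : Type*} (s : Finset ι) (f : ι → ℝ)
    (hf : Set.InjOn f s) (g : ℕ → ℝ) :
    ∑ i ∈ s, g (s.filter fun j => f i ≤ f j).card = ∑ l ∈ Finset.range s.card, g (l + 1) := by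
  classical
  have hinj : Set.InjOn (fun i => (s.filter fun j => f i ≤ f j).card) s := by
    intro a ha b hb hab
    by_contra hne
    have hfne : f a ≠ f b := fun h => hne (hf ha hb h)
    have key : ∀ a ∈ s, ∀ b ∈ s, f a < f b →
        (s.filter fun j => f b ≤ f j).card < (s.filter fun j => f a ≤ f j).card := by
      intro a ha b hb h
      apply Finset.card_lt_card
      refine ⟨fun j hj => ?_, fun hsub => ?_⟩
      · simp only [Finset.mem_filter] at hj ⊢
        exact ⟨hj.1, h.le.trans hj.2⟩
      · have := hsub (Finset.mem_filter.2 ⟨ha, le_rfl⟩)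
        exact absurd (Finset.mem_filter.1 this).2 (not_le.2 h)
    rcases lt_or_gt_of_ne hfne with h | h
    · exact absurd hab (key a ha b hb h).ne'
    · exact absurd hab (key b hb a ha h).ne
  -- The reversed ranks are distinct and lie in {1, …, #s}, hence they exhaust it.
  have himg : s.image (fun i => (s.filter fun j => f i ≤ f j).card) =
      (Finset.range s.card).image (· + 1) := by
    apply Finset.eq_of_subset_of_card_le
    · intro m hm
      obtain ⟨i, hi, rfl⟩ := Finset.mem_image.1 hm
      have h1 : 0 < (s.filter fun j => f i ≤ f j).card :=
        Finset.card_pos.2 ⟨i, Finset.mem_filter.2 ⟨hi, le_rfl⟩⟩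
      have h2 : (s.filter fun j => f i ≤ f j).card ≤ s.card := Finset.card_filter_le _ _
      exact Finset.mem_image.2 ⟨(s.filter fun j => f i ≤ f j).card - 1,
        Finset.mem_range.2 (by omega), by omega⟩
    · rw [Finset.card_image_of_injOn hinj]
      exact Finset.card_image_le.trans (Finset.card_range _).le
  rw [← Finset.sum_image (f := g) hinj, himg, Finset.sum_image (by simp)]

theorem sum_range_succ_cast (n : ℕ) :
    ∑ l ∈ Finset.range n, ((l + 1 : ℕ) : ℝ) = n * (n + 1) / 2 := by
  induction n with
  | zero => simp
  | succ n ih => rw [Finset.sum_range_succ, ih]; push_cast; ring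

theorem sum_range_succ_cast_sq (n : ℕ) :
    ∑ l ∈ Finset.range n, ((l + 1 : ℕ) : ℝ) ^ 2 = n * (n + 1) * (2 * n + 1) / 6 := by
  induction n with
  | zero => simp
  | succ n ih => rw [Finset.sum_range_succ, ih]; push_cast; ring

/-- A nearest neighbour map of distinct reals takes every value at most twice. -/
theorem IsNearestNeighbourMap.card_fiber_le {n : ℕ} {z : Fin n → ℝ} {M : Fin n → Fin n}
    (hM : IsNearestNeighbourMap z M) (hz : Function.Injective z) (m : Fin n) :
    (Finset.univ.filter fun i => M i = m).card ≤ 2 := by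
  classical
  have hsub : (Finset.univ.filter fun i => M i = m) ⊆
      (Finset.univ.filter fun i => M i = m ∧ z i < z m) ∪
        (Finset.univ.filter fun i => M i = m ∧ z m < z i) := by
    intro i hi
    simp only [Finset.mem_filter, Finset.mem_univ, true_and, Finset.mem_union] at hi ⊢
    have : z i ≠ z m := fun h => (hM i).1 (hi.trans (hz h).symm)
    rcases lt_or_gt_of_ne this with h | h
    · exact Or.inl ⟨hi, h⟩
    · exact Or.inr ⟨hi, h⟩
  -- Of two points on the same side of `z m`, the farther one is closer to the nearer one than to `z
  -- m`.
  have h1 : (Finset.univ.filter fun i => M i = m ∧ z i < z m).card ≤ 1 := by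
    refine Finset.card_le_one.2 fun a ha b hb => ?_
    simp only [Finset.mem_filter, Finset.mem_univ, true_and] at ha hb
    by_contra hab
    have h1 := (hM a).2 b (Ne.symm hab)
    have h2 := (hM b).2 a hab
    have hne : z a ≠ z b := fun h => hab (hz h)
    rw [ha.1] at h1
    rw [hb.1] at h2
    grind
  have h2 : (Finset.univ.filter fun i => M i = m ∧ z m < z i).card ≤ 1 := by
    refine Finset.card_le_one.2 fun a ha b hb => ?_
    simp only [Finset.mem_filter, Finset.mem_univ, true_and] at ha hb
    by_contra hab
    have h1 := (hM a).2 b (Ne.symm hab)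
    have h2 := (hM b).2 a hab
    have hne : z a ≠ z b := fun h => hab (hz h)
    rw [ha.1] at h1
    rw [hb.1] at h2
    grind
  calc _ ≤ _ := Finset.card_le_card hsub
    _ ≤ _ := Finset.card_union_le _ _
    _ ≤ 2 := by omega

theorem acR_eq_sum {n : ℕ} (y : Fin n → ℝ) (i : Fin n) :
    (acR y i : ℝ) = ∑ j, if y j ≤ y i then (1 : ℝ) else 0 := by
  simp [acR, Finset.sum_boole]

theorem acL_eq_sum {n : ℕ} (y : Fin n → ℝ) (i : Fin n) :
    (acL y i : ℝ) = ∑ j, if y i ≤ y j then (1 : ℝ) else 0 := by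
  simp [acL, Finset.sum_boole]

theorem sum_acR_eq_sum_acL {n : ℕ} (y : Fin n → ℝ) :
    ∑ i, (acR y i : ℝ) = ∑ i, (acL y i : ℝ) := by
  simp_rw [acR_eq_sum, acL_eq_sum]
  exact Finset.sum_comm

theorem acL_le {n : ℕ} (y : Fin n → ℝ) (i : Fin n) : (acL y i : ℝ) ≤ n := by
  have : acL y i ≤ n := (Finset.card_filter_le _ _).trans (by simp)
  exact_mod_cast this

/-- The statistic is uniformly bounded as soon as `M` takes every value at most twice. -/
theorem abs_acTn_le {n : ℕ} (y : Fin n → ℝ) (M : Fin n → Fin n)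
    (hM : ∀ m, (Finset.univ.filter fun i => M i = m).card ≤ 2) : |acTn y M| ≤ 3 := by
  classical
  set D := ∑ i, (acL y i : ℝ) * ((n : ℝ) - (acL y i : ℝ)) with hD
  set N := ∑ i, ((n : ℝ) * min (acR y i : ℝ) (acR y (M i) : ℝ) - (acL y i : ℝ) ^ 2) with hN
  set d : Fin n → ℝ := fun i => (acR y i : ℝ) - min (acR y i : ℝ) (acR y (M i) : ℝ) with hd
  have hL0 : ∀ i, (0 : ℝ) ≤ acL y i := fun i => Nat.cast_nonneg _
  have hD0 : 0 ≤ D := Finset.sum_nonneg fun i _ =>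
    mul_nonneg (hL0 i) (sub_nonneg.2 (acL_le y i))
  -- The ranks R and L have the same sum, so the numerator falls short of the denominator exactly by
  -- n times the total rank drop from i to M(i).
  have hND : N = D - n * ∑ i, d i := by
    have e : N - D + n * ∑ i, d i = n * (∑ i, (acR y i : ℝ) - ∑ i, (acL y i : ℝ)) := by
      rw [hN, hD, Finset.mul_sum, ← Finset.sum_sub_distrib, ← Finset.sum_add_distrib,
        ← Finset.sum_sub_distrib, Finset.mul_sum]
      exact Finset.sum_congr rfl fun i _ => by simp only [hd]; ring
    rw [sum_acR_eq_sum_acL, sub_self, mul_zero] at e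
    linarith
  have hd0 : ∀ i, 0 ≤ d i := fun i => sub_nonneg.2 (min_le_left _ _)
  have hdle : ∀ i, d i ≤ ∑ j, if y (M i) < y j ∧ y j ≤ y i then (1 : ℝ) else 0 := by
    intro i
    have hnn : (0 : ℝ) ≤ ∑ j, if y (M i) < y j ∧ y j ≤ y i then (1 : ℝ) else 0 :=
      Finset.sum_nonneg fun j _ => by split_ifs <;> norm_num
    rcases le_total (acR y i : ℝ) (acR y (M i) : ℝ) with h | h
    · simp [hd, min_eq_left h]
    · simp only [hd, min_eq_right h]
      rw [acR_eq_sum, acR_eq_sum, ← Finset.sum_sub_distrib]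
      refine Finset.sum_le_sum fun j _ => ?_
      split_ifs <;> grind
  -- Fix j and count the i with y_{M(i)} < y_j ≤ y_i: there are at most L_j such i, and M(i) is one
  -- of n - L_j indices, each hit at most twice.
  have hsum : ∑ i, d i ≤ ∑ j, min (acL y j : ℝ) (2 * (n - acL y j)) := by
    refine (Finset.sum_le_sum fun i _ => hdle i).trans ?_
    rw [Finset.sum_comm]
    refine Finset.sum_le_sum fun j _ => le_min ?_ ?_
    · rw [acL_eq_sum]
      exact Finset.sum_le_sum fun i _ => by split_ifs <;> grind
    · calc ∑ i, (if y (M i) < y j ∧ y j ≤ y i then (1 : ℝ) else 0)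
          ≤ ∑ i, ∑ m, if M i = m ∧ y m < y j then (1 : ℝ) else 0 := by
            refine Finset.sum_le_sum fun i _ => ?_
            refine le_trans ?_ (Finset.single_le_sum (f := fun m =>
              if M i = m ∧ y m < y j then (1 : ℝ) else 0)
              (fun m _ => by split_ifs <;> norm_num) (Finset.mem_univ (M i)))
            split_ifs <;> grind
        _ = ∑ m, ∑ i, if M i = m ∧ y m < y j then (1 : ℝ) else 0 := Finset.sum_comm
        _ ≤ ∑ m, 2 * (1 - if y j ≤ y m then (1 : ℝ) else 0) := by
            refine Finset.sum_le_sum fun m _ => ?_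
            by_cases hm : y m < y j
            · have h2 : ((Finset.univ.filter fun i => M i = m).card : ℝ) ≤ 2 := by
                exact_mod_cast hM m
              simpa [hm, Finset.sum_boole, not_le.2 hm] using h2
            · simp [hm, not_lt.1 hm]
        _ = 2 * (n - acL y j) := by
            rw [← Finset.mul_sum, Finset.sum_sub_distrib, acL_eq_sum]
            simp
  -- Either n ≤ 2(n - L) or n ≤ 2L, so n min(L, 2(n - L)) ≤ 4 L (n - L). Hence -3D ≤ N ≤ D.
  have h4 : n * ∑ i, d i ≤ 4 * D := by
    refine (mul_le_mul_of_nonneg_left hsum (Nat.cast_nonneg n)).trans ?_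
    rw [hD, Finset.mul_sum, Finset.mul_sum]
    refine Finset.sum_le_sum fun j _ => ?_
    have h1 := acL_le y j
    have h0 := hL0 j
    rcases le_total (2 * (acL y j : ℝ)) n with h | h
    · refine (mul_le_mul_of_nonneg_left (min_le_left _ _) (Nat.cast_nonneg n)).trans ?_
      nlinarith
    · refine (mul_le_mul_of_nonneg_left (min_le_right _ _) (Nat.cast_nonneg n)).trans ?_
      nlinarith
  have hds : 0 ≤ n * ∑ i, d i :=
    mul_nonneg (Nat.cast_nonneg n) (Finset.sum_nonneg fun i _ => hd0 i)
  have habs : |N| ≤ 3 * D := abs_le.2 ⟨by linarith, by linarith⟩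
  change |N / D| ≤ 3
  rw [abs_div, abs_of_nonneg hD0]
  exact div_le_of_le_mul₀ hD0 (by norm_num) habs

/-- Without ties the statistic only depends on the sum of the minima of the ranks. -/
theorem acTn_of_injective {n : ℕ} (hn : 2 ≤ n) {r : Fin n → ℝ} (hr : Function.Injective r)
    (M : Fin n → Fin n) :
    acTn r M = (6 * ∑ i, min (acR r i : ℝ) (acR r (M i) : ℝ) - (n + 1) * (2 * n + 1)) /
      ((n : ℝ) ^ 2 - 1) := by
  have h1 : ∑ i, (acL r i : ℝ) = n * (n + 1) / 2 := by
    have := sum_card_filter_le Finset.univ r hr.injOn (fun l => (l : ℝ))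
    simp only [Finset.card_univ, Fintype.card_fin] at this
    rw [sum_range_succ_cast] at this
    exact this
  have h2 : ∑ i, (acL r i : ℝ) ^ 2 = n * (n + 1) * (2 * n + 1) / 6 := by
    have := sum_card_filter_le Finset.univ r hr.injOn (fun l => (l : ℝ) ^ 2)
    simp only [Finset.card_univ, Fintype.card_fin] at this
    rw [sum_range_succ_cast_sq] at this
    exact this
  have hn' : (2 : ℝ) ≤ n := by exact_mod_cast hn
  have e : ∑ i, (acL r i : ℝ) * ((n : ℝ) - (acL r i : ℝ)) = n * (n ^ 2 - 1) / 6 := by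
    have : ∀ i, (acL r i : ℝ) * ((n : ℝ) - (acL r i : ℝ)) = n * acL r i - (acL r i : ℝ) ^ 2 :=
      fun i => by ring
    simp_rw [this]
    rw [Finset.sum_sub_distrib, ← Finset.mul_sum, h1, h2]
    ring
  have hne : (n : ℝ) ^ 2 - 1 ≠ 0 := by nlinarith
  have hne' : (n : ℝ) ≠ 0 := by linarith
  rw [acTn, e, Finset.sum_sub_distrib, ← Finset.mul_sum, h2]
  field_simp

/-! ### Reduction of the statistic to a lexicographic count. -/

/-- The count of pairs `(i, j)` for which `(e_j, w_j)` is lexicographically at most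
`(min e_i e_{M(i)}, w_i)`. -/
noncomputable def lexCount {n : ℕ} (e w : Fin n → ℝ) (M : Fin n → Fin n) : ℝ :=
  ∑ i, ∑ j, if e j < min (e i) (e (M i)) ∨ (e j = min (e i) (e (M i)) ∧ w j ≤ w i)
    then (1 : ℝ) else 0

/-- For j other than i and M(i), `w j` lies on the same side of `w i` and of `w (M i)`, since
nothing separates nearest neighbours. Comparing with both residuals is then the same as comparing
with (min(e_i, e_{M(i)}), w_i). Only j = i and j = M(i) can disagree, which costs 2 per index i. -/
theorem abs_sum_min_acR_sub_lexCount_le {n : ℕ} {e w r : Fin n → ℝ} {M : Fin n → Fin n}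
    (hw : Function.Injective w) (hM : IsNearestNeighbourMap w M)
    (hr : ∀ i j, r j ≤ r i ↔ e j < e i ∨ (e j = e i ∧ w j ≤ w i)) :
    |∑ i, min (acR r i : ℝ) (acR r (M i) : ℝ) - lexCount e w M| ≤ 2 * n := by
  classical
  have hmin : ∀ i, min (acR r i : ℝ) (acR r (M i) : ℝ) =
      ∑ j, if r j ≤ r i ∧ r j ≤ r (M i) then (1 : ℝ) else 0 := by
    intro i
    rw [acR_eq_sum, acR_eq_sum]
    rcases le_total (r i) (r (M i)) with h | h
    · rw [min_eq_left (Finset.sum_le_sum fun j _ => by split_ifs <;> grind)]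
      exact Finset.sum_congr rfl fun j _ => by split_ifs <;> grind
    · rw [min_eq_right (Finset.sum_le_sum fun j _ => by split_ifs <;> grind)]
      exact Finset.sum_congr rfl fun j _ => by split_ifs <;> grind
  rw [lexCount, ← Finset.sum_sub_distrib]
  refine (Finset.abs_sum_le_sum_abs _ _).trans ?_
  have hle : ∀ i, |min (acR r i : ℝ) (acR r (M i) : ℝ) -
      ∑ j, (if e j < min (e i) (e (M i)) ∨ (e j = min (e i) (e (M i)) ∧ w j ≤ w i)
        then (1 : ℝ) else 0)| ≤ 2 := by
    intro i
    rw [hmin, ← Finset.sum_sub_distrib]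
    refine (Finset.abs_sum_le_sum_abs _ _).trans ?_
    calc _ ≤ ∑ j, ((if j = i then (1 : ℝ) else 0) + if j = M i then (1 : ℝ) else 0) := by
          refine Finset.sum_le_sum fun j _ => ?_
          by_cases hji : j = i
          · rw [if_pos hji]
            split_ifs <;> norm_num
          by_cases hjm : j = M i
          · rw [if_pos hjm]
            split_ifs <;> norm_num
          have hA : w j ≤ w i ↔ w j ≤ w (M i) := by
            have h1 := (hM i).2 j hji
            have h2 : w j ≠ w i := fun h => hji (hw h)
            have h3 : w j ≠ w (M i) := fun h => hjm (hw h)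
            constructor <;> intro h <;> grind
          have hiff : (r j ≤ r i ∧ r j ≤ r (M i)) ↔
              (e j < min (e i) (e (M i)) ∨ (e j = min (e i) (e (M i)) ∧ w j ≤ w i)) := by
            rw [hr, hr, ← hA]
            grind
          simp [hiff, hji, hjm]
      _ = 2 := by
          rw [Finset.sum_add_distrib]
          simp
          norm_num
  calc _ ≤ ∑ _i : Fin n, (2 : ℝ) := Finset.sum_le_sum fun i _ => hle i
    _ = 2 * n := by simp [mul_comm]

theorem abs_acTn_sub_le {n : ℕ} (hn : 2 ≤ n) {e w r : Fin n → ℝ} {M : Fin n → Fin n}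
    (hw : Function.Injective w) (hM : IsNearestNeighbourMap w M)
    (hr : ∀ i j, r j ≤ r i ↔ e j < e i ∨ (e j = e i ∧ w j ≤ w i))
    {v : ℝ} (hv0 : 0 ≤ v) (hv1 : v ≤ 1) :
    |acTn r M - (6 * v - 2)| ≤ 8 * |lexCount e w M / n ^ 2 - v| + 34 / n := by
  have hinj : Function.Injective r := by
    intro i j hij
    have h1 := (hr i j).1 hij.symm.le
    have h2 := (hr j i).1 hij.le
    apply hw
    grind
  have hlex := abs_sum_min_acR_sub_lexCount_le hw hM hr
  rw [acTn_of_injective hn hinj]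
  set m := ∑ i, min (acR r i : ℝ) (acR r (M i) : ℝ)
  set Q := lexCount e w M
  have hn' : (2 : ℝ) ≤ n := by exact_mod_cast hn
  have hpos : (0 : ℝ) < n ^ 2 - 1 := by nlinarith
  have hn0 : (0 : ℝ) < n := by linarith
  set η := Q / n ^ 2 - v with hη
  have hQ : Q = n ^ 2 * (v + η) := by rw [hη]; field_simp; ring
  have e1 : (6 * m - (n + 1) * (2 * n + 1)) / ((n : ℝ) ^ 2 - 1) - (6 * v - 2) =
      (6 * (m - Q) + 6 * n ^ 2 * η + (6 * v - 3 * (n + 1))) / (n ^ 2 - 1) := by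
    rw [hQ]
    field_simp
    ring
  rw [e1, abs_div, abs_of_pos hpos, div_le_iff₀ hpos]
  have hb : |6 * (m - Q) + 6 * n ^ 2 * η + (6 * v - 3 * (n + 1))| ≤
      12 * n + 6 * n ^ 2 * |η| + 3 * (n + 1) := by
    refine (abs_add_le _ _).trans (add_le_add ((abs_add_le _ _).trans (add_le_add ?_ ?_)) ?_)
    · rw [abs_mul]; norm_num; linarith
    · rw [abs_mul, abs_of_nonneg (by positivity)]
    · rw [abs_le]; constructor <;> linarith
  refine hb.trans ?_
  have h3 : (34 / n : ℝ) * (n ^ 2 - 1) ≥ 34 * n - 17 := by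
    have : (34 / n : ℝ) * (n ^ 2 - 1) = 34 * n - 34 / n := by field_simp
    rw [this]
    have : (34 : ℝ) / n ≤ 17 := by rw [div_le_iff₀ hn0]; linarith
    linarith
  -- The constant 8 comes from 6n² ≤ 8(n² - 1), valid for n ≥ 2; 34 absorbs the linear terms 12n +
  -- 3(n + 1).
  have h4 : 6 * (n : ℝ) ^ 2 * |η| ≤ 8 * |η| * (n ^ 2 - 1) := by
    have := abs_nonneg η
    nlinarith [mul_nonneg this (by nlinarith : (0 : ℝ) ≤ n ^ 2 - 4)]
  nlinarith

/-- Splitting by the value s of `e j` and by the order of `w i`, `w j` turns the minimum into a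
product: s < min and s ≤ min factor into a condition on `e i` and one on `e (M i)`. This is the
trilinear form to which the concentration bound applies. -/
theorem lexCount_eq {n : ℕ} (S : Finset ℝ) {e w : Fin n → ℝ} (he : ∀ i, e i ∈ S)
    (M : Fin n → Fin n) :
    lexCount e w M = ∑ s ∈ S,
      ((∑ i, ∑ j, (if e j = s then (1 : ℝ) else 0) * (if s < e i then (1 : ℝ) else 0) *
          (if s < e (M i) then (1 : ℝ) else 0) * (if w i < w j then (1 : ℝ) else 0)) +
        ∑ i, ∑ j, (if e j = s then (1 : ℝ) else 0) * (if s ≤ e i then (1 : ℝ) else 0) *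
          (if s ≤ e (M i) then (1 : ℝ) else 0) * (if w j ≤ w i then (1 : ℝ) else 0)) := by
  simp_rw [← Finset.sum_add_distrib]
  rw [lexCount]
  conv_rhs => rw [Finset.sum_comm]
  refine Finset.sum_congr rfl fun i _ => ?_
  conv_rhs => rw [Finset.sum_comm]
  refine Finset.sum_congr rfl fun j _ => ?_
  rw [Finset.sum_eq_single_of_mem (e j) (he j) fun s _ hs => by simp [Ne.symm hs]]
  rcases le_or_gt (w j) (w i) with h | h
  · simp [h, not_lt.2 h]
    grind
  · simp [h, not_le.2 h]
    grind

/-! ### Second moments of sums with orthogonal noise. -/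

section SecondMoment

variable {Ω : Type*} [MeasurableSpace Ω] {P : Measure Ω} [IsProbabilityMeasure P]

theorem integrable_of_abs_le {f : Ω → ℝ} (hf : Measurable f) {K : ℝ} (hK : ∀ ω, |f ω| ≤ K) :
    Integrable f P :=
  Integrable.of_bound hf.aestronglyMeasurable K (ae_of_all _ hK)

theorem integral_abs_le_of_integral_sq_le {Z : Ω → ℝ} (hZ : Measurable Z) {K : ℝ}
    (hK : ∀ ω, |Z ω| ≤ K) {s : ℝ} (hs : 0 ≤ s) (h : ∫ ω, Z ω ^ 2 ∂P ≤ s ^ 2) :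
    Integrable (fun ω => |Z ω|) P ∧ ∫ ω, |Z ω| ∂P ≤ s := by
  refine ⟨integrable_of_abs_le hZ.abs (K := K) fun ω => by simpa using hK ω, ?_⟩
  have hmem : MemLp (fun ω => |Z ω|) 2 P :=
    MemLp.of_bound hZ.abs.aestronglyMeasurable K (ae_of_all _ fun ω => by simpa using hK ω)
  have hv := variance_nonneg (fun ω => |Z ω|) P
  rw [variance_eq_sub hmem] at hv
  simp only [Pi.pow_apply, sq_abs] at hv
  exact (le_abs_self _).trans (abs_le_of_sq_le_sq (by linarith) hs)

/-- A second moment bound for sums `∑ C a * B a` where the coefficients `C` are independent of `B`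
and `B a`, `B b` are orthogonal except when `b = a` or `b = τ a`. -/
theorem integral_sq_sum_mul_le {T : Type*} [Fintype T] [DecidableEq T] {C B : T → Ω → ℝ}
    (hC : ∀ a, Measurable (C a)) (hB : ∀ a, Measurable (B a)) {K : ℝ}
    (hCK : ∀ a ω, |C a ω| ≤ K) (hB1 : ∀ a ω, |B a ω| ≤ 1)
    (hind : IndepFun (fun ω a => C a ω) (fun ω a => B a ω) P) (τ : T ≃ T)
    (horth : ∀ a b, b ≠ a → b ≠ τ a → ∫ ω, B a ω * B b ω ∂P = 0) :
    ∫ ω, (∑ a, C a ω * B a ω) ^ 2 ∂P ≤ 2 * ∫ ω, ∑ a, C a ω ^ 2 ∂P := by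
  have hCC : ∀ a b, Integrable (fun ω => C a ω * C b ω) P := fun a b =>
    integrable_of_abs_le ((hC a).mul (hC b)) (K := K * K) fun ω => by
      rw [abs_mul]
      exact mul_le_mul (hCK a ω) (hCK b ω) (abs_nonneg _) ((abs_nonneg _).trans (hCK a ω))
  have hBB1 : ∀ a b ω, |B a ω * B b ω| ≤ 1 := fun a b ω => by
    rw [abs_mul]
    exact mul_le_one₀ (hB1 a ω) (abs_nonneg _) (hB1 b ω)
  have hBB : ∀ a b, Integrable (fun ω => B a ω * B b ω) P := fun a b =>
    integrable_of_abs_le ((hB a).mul (hB b)) (hBB1 a b)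
  have hC2 : ∀ a, Integrable (fun ω => C a ω ^ 2) P := fun a => by
    simpa [sq] using hCC a a
  have hindab : ∀ a b, IndepFun (fun ω => C a ω * C b ω) (fun ω => B a ω * B b ω) P := by
    intro a b
    exact hind.comp (φ := fun c : T → ℝ => c a * c b) (ψ := fun c : T → ℝ => c a * c b)
      (by fun_prop) (by fun_prop)
  have hprod : ∀ a b, ∫ ω, (C a ω * C b ω) * (B a ω * B b ω) ∂P =
      (∫ ω, C a ω * C b ω ∂P) * ∫ ω, B a ω * B b ω ∂P := fun a b =>
    (hindab a b).integral_fun_mul_eq_mul_integral (hCC a b).1 (hBB a b).1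
  have hexp : ∫ ω, (∑ a, C a ω * B a ω) ^ 2 ∂P =
      ∑ a, ∑ b, (∫ ω, C a ω * C b ω ∂P) * ∫ ω, B a ω * B b ω ∂P := by
    have : ∀ ω, (∑ a, C a ω * B a ω) ^ 2 =
        ∑ a, ∑ b, (C a ω * C b ω) * (B a ω * B b ω) := fun ω => by
      rw [sq, Finset.sum_mul_sum]
      exact Finset.sum_congr rfl fun a _ => Finset.sum_congr rfl fun b _ => by ring
    simp_rw [this, ← hprod]
    have hi : ∀ a b, Integrable (fun ω => (C a ω * C b ω) * (B a ω * B b ω)) P := fun a b =>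
      (hindab a b).integrable_mul (hCC a b) (hBB a b)
    rw [integral_finsetSum _ fun a _ => integrable_finsetSum _ fun b _ => hi a b]
    exact Finset.sum_congr rfl fun a _ => integral_finsetSum _ fun b _ => hi a b
  have habs : ∀ a b, (∫ ω, C a ω * C b ω ∂P) * ∫ ω, B a ω * B b ω ∂P ≤
      ((∫ ω, C a ω ^ 2 ∂P) + ∫ ω, C b ω ^ 2 ∂P) / 2 := by
    intro a b
    have h1 : |∫ ω, B a ω * B b ω ∂P| ≤ 1 := by
      have := norm_integral_le_of_norm_le_const (μ := P) (f := fun ω => B a ω * B b ω)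
        (ae_of_all _ fun ω => hBB1 a b ω)
      simpa using this
    have h2 : |∫ ω, C a ω * C b ω ∂P| ≤ ((∫ ω, C a ω ^ 2 ∂P) + ∫ ω, C b ω ^ 2 ∂P) / 2 := by
      rw [← integral_add (hC2 a) (hC2 b), ← integral_div]
      refine (abs_integral_le_integral_abs).trans
        (integral_mono (hCC a b).abs (((hC2 a).add (hC2 b)).div_const 2) fun ω => ?_)
      simp only [abs_mul]
      nlinarith [sq_nonneg (|C a ω| - |C b ω|), sq_abs (C a ω), sq_abs (C b ω)]
    calc _ ≤ |(∫ ω, C a ω * C b ω ∂P) * ∫ ω, B a ω * B b ω ∂P| := le_abs_self _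
      _ ≤ _ := by
        rw [abs_mul]
        exact (mul_le_of_le_one_right (abs_nonneg _) h1).trans h2
  have hnn : ∀ a, 0 ≤ ∫ ω, C a ω ^ 2 ∂P := fun a => integral_nonneg fun ω => sq_nonneg _
  rw [hexp, integral_finsetSum _ fun a _ => hC2 a]
  -- Each row keeps only the columns a and τ a; when they differ, the arithmetic-geometric
  -- inequality splits the τ a term, and reindexing by τ gives the factor 2.
  calc _ ≤ ∑ a, ∑ b, ((if b = a then ∫ ω, C a ω ^ 2 ∂P else 0) +
        if b = τ a then ((∫ ω, C a ω ^ 2 ∂P) + ∫ ω, C (τ a) ω ^ 2 ∂P) / 2 else 0) := by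
        refine Finset.sum_le_sum fun a _ => Finset.sum_le_sum fun b _ => ?_
        have hA := hnn a
        have hT := hnn (τ a)
        by_cases h1 : b = a
        · rw [if_pos h1, h1]
          have := habs a a
          split_ifs <;> linarith
        · rw [if_neg h1, zero_add]
          by_cases h2 : b = τ a
          · rw [if_pos h2, h2]
            exact habs a (τ a)
          · rw [if_neg h2, horth a b h1 h2, mul_zero]
    _ = ∑ a, ((∫ ω, C a ω ^ 2 ∂P) +
        ((∫ ω, C a ω ^ 2 ∂P) + ∫ ω, C (τ a) ω ^ 2 ∂P) / 2) := by
        refine Finset.sum_congr rfl fun a _ => ?_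
        rw [Finset.sum_add_distrib]
        simp
    _ = _ := by
        rw [Finset.sum_add_distrib, ← Finset.sum_div, Finset.sum_add_distrib,
          Equiv.sum_comp τ fun a => ∫ ω, C a ω ^ 2 ∂P]
        ring

end SecondMoment

theorem integral_mul_eq_zero_of_iIndepFun {Ω : Type*} [MeasurableSpace Ω]
    {P : Measure Ω} {ι : Type*} {b : ι → Ω → ℝ} (hb : ∀ i, Measurable (b i))
    (hind : iIndepFun b P) {i j : ι} (hi : ∫ ω, b i ω ∂P = 0) (hij : i ≠ j) :
    ∫ ω, b i ω * b j ω ∂P = 0 := by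
  have := (hind.indepFun hij).integral_fun_mul_eq_mul_integral
    (hb i).aestronglyMeasurable (hb j).aestronglyMeasurable
  rw [this, hi, zero_mul]

/-- One centred factor whose index occurs only once kills the product; j, k, l may coincide among
themselves. -/
theorem integral_mul_mul_mul_eq_zero_of_iIndepFun {Ω : Type*} [MeasurableSpace Ω]
    {P : Measure Ω} {ι : Type*} {b : ι → Ω → ℝ}
    (hb : ∀ i, Measurable (b i)) (hind : iIndepFun b P) {i j k l : ι}
    (hi : ∫ ω, b i ω ∂P = 0) (hij : i ≠ j) (hik : i ≠ k) (hil : i ≠ l) :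
    ∫ ω, b i ω * (b j ω * (b k ω * b l ω)) ∂P = 0 := by
  classical
  have h := hind.indepFun_finset {i} {j, k, l}
    (by simp [hij, hik, hil]) hb
  have hm : ∀ t : ({j, k, l} : Finset ι),
      Measurable fun c : ({j, k, l} : Finset ι) → ℝ => c t := measurable_pi_apply
  have hi' : i ∈ ({i} : Finset ι) := by simp
  have hj' : j ∈ ({j, k, l} : Finset ι) := by simp
  have hk' : k ∈ ({j, k, l} : Finset ι) := by simp
  have hl' : l ∈ ({j, k, l} : Finset ι) := by simp
  have hm0 : Measurable fun c : ({i} : Finset ι) → ℝ => c ⟨i, hi'⟩ := measurable_pi_apply _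
  have h' := h.comp hm0 ((hm ⟨j, hj'⟩).mul ((hm ⟨k, hk'⟩).mul (hm ⟨l, hl'⟩)))
  have := h'.integral_fun_mul_eq_mul_integral (hb i).aestronglyMeasurable
    ((hb j).mul ((hb k).mul (hb l))).aestronglyMeasurable
  refine this.trans ?_
  simp only [Function.comp_def, hi, zero_mul]

/-! ### Concentration of the trilinear sums. -/

/-- With g' = g(M(i)), h g g' - q p² = g g' (h - q) + q p (g - p) + q p (g' - p) + q (g - p)(g' -
p). The terms containing M are rewritten as sums over m, or over pairs (i, m), so that M enters only
the coefficients and the noise factors have fixed indices. In the first term g g' ≤ 1 is discarded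
for each i, so coincidences of j with i or M(i) do no harm. -/
theorem abs_trilinear_sum_sub_le {n : ℕ} {M : Fin n → Fin n} (hMne : ∀ i, M i ≠ i)
    {h g : Fin n → ℝ} {W : Fin n → Fin n → ℝ} {q p : ℝ} (hq0 : 0 ≤ q) (hq1 : q ≤ 1)
    (hp0 : 0 ≤ p) (hp1 : p ≤ 1) (hg0 : ∀ i, 0 ≤ g i) (hg1 : ∀ i, g i ≤ 1) :
    |∑ i, ∑ j, h j * g i * g (M i) * W i j - q * p ^ 2 * ∑ i, ∑ j, W i j| ≤
      ∑ i, |∑ j, W i j * (h j - q)| + |∑ i, (∑ j, W i j) * (g i - p)| +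
        |∑ m, (∑ i, if M i = m then ∑ j, W i j else 0) * (g m - p)| +
        |∑ a : Fin n × Fin n, (if M a.1 = a.2 then ∑ j, W a.1 j else 0) *
          (if a.1 = a.2 then 0 else (g a.1 - p) * (g a.2 - p))| := by
  have e3 : ∑ m, (∑ i, if M i = m then ∑ j, W i j else 0) * (g m - p) =
      ∑ i, (∑ j, W i j) * (g (M i) - p) := by
    simp_rw [Finset.sum_mul]
    rw [Finset.sum_comm]
    refine Finset.sum_congr rfl fun i _ => ?_
    rw [← Finset.sum_mul, Finset.sum_eq_single_of_mem (M i) (Finset.mem_univ _)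
      fun m _ hm => by rw [if_neg (Ne.symm hm), zero_mul]]
    rw [if_pos rfl, Finset.sum_mul]
  have e4 : ∑ a : Fin n × Fin n, (if M a.1 = a.2 then ∑ j, W a.1 j else 0) *
      (if a.1 = a.2 then 0 else (g a.1 - p) * (g a.2 - p)) =
      ∑ i, (∑ j, W i j) * ((g i - p) * (g (M i) - p)) := by
    rw [Fintype.sum_prod_type]
    refine Finset.sum_congr rfl fun i _ => ?_
    rw [Finset.sum_eq_single_of_mem (M i) (Finset.mem_univ _)
      fun m _ hm => by rw [if_neg (Ne.symm hm), zero_mul]]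
    rw [if_pos rfl, if_neg (hMne i).symm]
  have e : ∑ i, ∑ j, h j * g i * g (M i) * W i j - q * p ^ 2 * ∑ i, ∑ j, W i j =
      ∑ i, g i * g (M i) * (∑ j, W i j * (h j - q)) + q * p * ∑ i, (∑ j, W i j) * (g i - p) +
        q * p * ∑ i, (∑ j, W i j) * (g (M i) - p) +
        q * ∑ i, (∑ j, W i j) * ((g i - p) * (g (M i) - p)) := by
    simp_rw [Finset.mul_sum, ← Finset.sum_sub_distrib, Finset.sum_mul, Finset.mul_sum,
      ← Finset.sum_add_distrib]
    exact Finset.sum_congr rfl fun i _ => Finset.sum_congr rfl fun j _ => by ring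
  rw [e3, e4, e]
  have hqp0 : 0 ≤ q * p := mul_nonneg hq0 hp0
  have hqp1 : q * p ≤ 1 := mul_le_one₀ hq1 hp0 hp1
  refine (abs_add_le _ _).trans (add_le_add ((abs_add_le _ _).trans
    (add_le_add ((abs_add_le _ _).trans (add_le_add ?_ ?_)) ?_)) ?_)
  · refine (Finset.abs_sum_le_sum_abs _ _).trans (Finset.sum_le_sum fun i _ => ?_)
    rw [abs_mul, abs_of_nonneg (mul_nonneg (hg0 i) (hg0 _))]
    exact mul_le_of_le_one_left (abs_nonneg _) (mul_le_one₀ (hg1 i) (hg0 _) (hg1 _))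
  · rw [abs_mul, abs_of_nonneg hqp0]
    exact mul_le_of_le_one_left (abs_nonneg _) hqp1
  · rw [abs_mul, abs_of_nonneg hqp0]
    exact mul_le_of_le_one_left (abs_nonneg _) hqp1
  · rw [abs_mul, abs_of_nonneg hq0]
    exact mul_le_of_le_one_left (abs_nonneg _) hq1

section Trilinear

variable {Ω : Type*} [MeasurableSpace Ω] {P : Measure Ω} [IsProbabilityMeasure P]

theorem integral_abs_sum_mul_le_of_iIndepFun {n : ℕ} {C b : Fin n → Ω → ℝ}
    (hC : ∀ i, Measurable (C i)) (hb : ∀ i, Measurable (b i)) {K : ℝ}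
    (hCK : ∀ i ω, |C i ω| ≤ K) (hb1 : ∀ i ω, |b i ω| ≤ 1) (hb0 : ∀ i, ∫ ω, b i ω ∂P = 0)
    (hbind : iIndepFun b P)
    (hind : IndepFun (fun ω i => C i ω) (fun ω i => b i ω) P) {s : ℝ} (hs : 0 ≤ s)
    (h : ∀ᵐ ω ∂P, 2 * ∑ i, C i ω ^ 2 ≤ s ^ 2) :
    Integrable (fun ω => |∑ i, C i ω * b i ω|) P ∧ ∫ ω, |∑ i, C i ω * b i ω| ∂P ≤ s := by
  refine integral_abs_le_of_integral_sq_le (K := n * K)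
    (Finset.measurable_sum _ fun i _ => (hC i).fun_mul (hb i)) (fun ω => ?_) hs ?_
  · refine (Finset.abs_sum_le_sum_abs _ _).trans ?_
    calc _ ≤ ∑ _i : Fin n, K := Finset.sum_le_sum fun i _ => by
          rw [abs_mul]
          exact (mul_le_of_le_one_right (abs_nonneg _) (hb1 i ω)).trans (hCK i ω)
      _ = n * K := by simp
  · refine (integral_sq_sum_mul_le hC hb hCK hb1 hind (Equiv.refl _) fun a c hca _ =>
      integral_mul_eq_zero_of_iIndepFun hb hbind (hb0 a) (Ne.symm hca)).trans ?_
    rw [← integral_const_mul]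
    have hi : Integrable (fun ω => 2 * ∑ i, C i ω ^ 2) P :=
      (integrable_finsetSum _ fun i _ => integrable_of_abs_le ((hC i).pow_const 2)
        (K := K ^ 2) fun ω => by
          rw [abs_pow]
          exact pow_le_pow_left₀ (abs_nonneg _) (hCK i ω) 2).const_mul 2
    simpa using integral_mono_ae hi (integrable_const (s ^ 2)) h

theorem integral_abs_sum_mul_pair_le_of_iIndepFun {n : ℕ} {C : Fin n × Fin n → Ω → ℝ}
    {b : Fin n → Ω → ℝ}
    (hC : ∀ a, Measurable (C a)) (hb : ∀ i, Measurable (b i)) {K : ℝ}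
    (hCK : ∀ a ω, |C a ω| ≤ K) (hb1 : ∀ i ω, |b i ω| ≤ 1) (hb0 : ∀ i, ∫ ω, b i ω ∂P = 0)
    (hbind : iIndepFun b P)
    (hind : IndepFun (fun ω a => C a ω) (fun ω i => b i ω) P) {s : ℝ} (hs : 0 ≤ s)
    (h : ∀ᵐ ω ∂P, 2 * ∑ a, C a ω ^ 2 ≤ s ^ 2) :
    Integrable (fun ω => |∑ a, C a ω * (if a.1 = a.2 then 0 else b a.1 ω * b a.2 ω)|) P ∧
      ∫ ω, |∑ a, C a ω * (if a.1 = a.2 then 0 else b a.1 ω * b a.2 ω)| ∂P ≤ s := by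
  set B : Fin n × Fin n → Ω → ℝ := fun a ω => if a.1 = a.2 then 0 else b a.1 ω * b a.2 ω with hB
  have hBm : ∀ a, Measurable (B a) := fun a => by
    simp only [hB]
    split_ifs
    · exact measurable_const
    · exact (hb _).mul (hb _)
  have hB1 : ∀ a ω, |B a ω| ≤ 1 := fun a ω => by
    simp only [hB]
    split_ifs
    · simp
    · rw [abs_mul]
      exact mul_le_one₀ (hb1 _ ω) (abs_nonneg _) (hb1 _ ω)
  have hindB : IndepFun (fun ω a => C a ω) (fun ω a => B a ω) P := by
    refine hind.comp (φ := id)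
      (ψ := fun c (a : Fin n × Fin n) => if a.1 = a.2 then 0 else c a.1 * c a.2)
      measurable_id (measurable_pi_lambda _ fun a => ?_)
    split_ifs
    · exact measurable_const
    · exact (measurable_pi_apply _).fun_mul (measurable_pi_apply _)
  have horth : ∀ a c, c ≠ a → c ≠ Equiv.prodComm _ _ a → ∫ ω, B a ω * B c ω ∂P = 0 := by
    rintro ⟨i, m⟩ ⟨i', m'⟩ h1 h2
    simp only [ne_eq, Prod.mk.injEq, Equiv.prodComm_apply, Prod.swap_prod_mk] at h1 h2
    by_cases him : i = m
    · simp [hB, him]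
    by_cases him' : i' = m'
    · simp [hB, him']
    simp only [hB, him, him', if_false]
    -- Two off-diagonal pairs that agree neither directly nor after a swap leave an index of the
    -- first pair outside the second.
    by_cases hi : i ≠ i' ∧ i ≠ m'
    · rw [← integral_mul_mul_mul_eq_zero_of_iIndepFun hb hbind (hb0 i) him hi.1 hi.2]
      exact integral_congr_ae (ae_of_all _ fun ω => by ring)
    · have hm : m ≠ i' ∧ m ≠ m' := by grind
      rw [← integral_mul_mul_mul_eq_zero_of_iIndepFun hb hbind (hb0 m) (Ne.symm him) hm.1 hm.2]
      exact integral_congr_ae (ae_of_all _ fun ω => by ring)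
  refine integral_abs_le_of_integral_sq_le (K := ∑ _a : Fin n × Fin n, K)
    (Finset.measurable_sum _ fun a _ => (hC a).fun_mul (hBm a)) (fun ω => ?_) hs ?_
  · refine (Finset.abs_sum_le_sum_abs _ _).trans (Finset.sum_le_sum fun a _ => ?_)
    rw [abs_mul]
    exact (mul_le_of_le_one_right (abs_nonneg _) (hB1 a ω)).trans (hCK a ω)
  · refine (integral_sq_sum_mul_le hC hBm hCK hB1 hindB (Equiv.prodComm _ _) horth).trans ?_
    rw [← integral_const_mul]
    have hi : Integrable (fun ω => 2 * ∑ a, C a ω ^ 2) P :=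
      (integrable_finsetSum _ fun a _ => integrable_of_abs_le ((hC a).pow_const 2)
        (K := K ^ 2) fun ω => by
          rw [abs_pow]
          exact pow_le_pow_left₀ (abs_nonneg _) (hCK a ω) 2).const_mul 2
    simpa using integral_mono_ae hi (integrable_const (s ^ 2)) h

/-- The random trilinear sum `∑ h(e_j) g(e_i) g(e_{M(i)}) W_ij(x)` concentrates in `L¹` when `e` is
an independent sequence, independent of `x`, and `M` is almost surely a function of `x`. -/
theorem exists_integrable_abs_trilinear_sub_le {n : ℕ} {x e : Fin n → Ω → ℝ} {M : Ω → Fin n → Fin n}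
    (hx : ∀ i, Measurable (x i)) (he : ∀ i, Measurable (e i))
    (hM : ∀ i, Measurable fun ω => M ω i)
    (hind : IndepFun (fun ω i => x i ω) (fun ω i => e i ω) P) (hiind : iIndepFun e P)
    {A : Fin n → Fin n → Set (Fin n → ℝ)} (hA : ∀ i m, MeasurableSet (A i m))
    (hMA : ∀ᵐ ω ∂P, ∀ i m, M ω i = m ↔ (fun l => x l ω) ∈ A i m)
    (hMne : ∀ᵐ ω ∂P, ∀ i, M ω i ≠ i)
    (hfib : ∀ᵐ ω ∂P, ∀ m, (Finset.univ.filter fun i => M ω i = m).card ≤ 2)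
    {h g : ℝ → ℝ} (hh : Measurable h) (hg : Measurable g)
    (hh0 : ∀ t, 0 ≤ h t) (hh1 : ∀ t, h t ≤ 1) (hg0 : ∀ t, 0 ≤ g t) (hg1 : ∀ t, g t ≤ 1)
    {q p : ℝ} (hq : ∀ i, ∫ ω, h (e i ω) ∂P = q) (hp : ∀ i, ∫ ω, g (e i ω) ∂P = p)
    (hq0 : 0 ≤ q) (hq1 : q ≤ 1) (hp0 : 0 ≤ p) (hp1 : p ≤ 1)
    {W : Fin n → Fin n → (Fin n → ℝ) → ℝ} (hW : ∀ i j, Measurable (W i j))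
    (hW0 : ∀ i j z, 0 ≤ W i j z) (hW1 : ∀ i j z, W i j z ≤ 1) :
    ∃ F : Ω → ℝ, Integrable F P ∧ (∀ᵐ ω ∂P,
      |∑ i, ∑ j, h (e j ω) * g (e i ω) * g (e (M ω i) ω) * W i j (fun l => x l ω) -
        q * p ^ 2 * ∑ i, ∑ j, W i j (fun l => x l ω)| ≤ F ω) ∧
      ∫ ω, F ω ∂P ≤ 9 * (n * √n) := by
  classical
  have hX : Measurable fun ω (l : Fin n) => x l ω := measurable_pi_lambda _ hx
  set V : Fin n → (Fin n → ℝ) → ℝ := fun i z => ∑ j, W i j z with hV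
  have hVm : ∀ i, Measurable (V i) := fun i => Finset.measurable_sum _ fun j _ => hW i j
  have hV0 : ∀ i z, 0 ≤ V i z := fun i z => Finset.sum_nonneg fun j _ => hW0 i j z
  have hVn : ∀ i z, V i z ≤ n := fun i z => by
    calc V i z ≤ ∑ _j : Fin n, (1 : ℝ) := Finset.sum_le_sum fun j _ => hW1 i j z
      _ = n := by simp
  have hVsq : ∀ i z, V i z ^ 2 ≤ (n : ℝ) ^ 2 := fun i z => pow_le_pow_left₀ (hV0 i z) (hVn i z) 2
  have hMset : ∀ i m, MeasurableSet {ω | M ω i = m} := fun i m => hM i (measurableSet_singleton m)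
  have hcm : ∀ i, Measurable fun ω => h (e i ω) - q := fun i => (hh.comp (he i)).sub_const q
  have hbm : ∀ i, Measurable fun ω => g (e i ω) - p := fun i => (hg.comp (he i)).sub_const p
  have hc1 : ∀ i ω, |h (e i ω) - q| ≤ 1 := fun i ω => abs_le.2
    ⟨by linarith [hh0 (e i ω)], by linarith [hh1 (e i ω)]⟩
  have hb1 : ∀ i ω, |g (e i ω) - p| ≤ 1 := fun i ω => abs_le.2
    ⟨by linarith [hg0 (e i ω)], by linarith [hg1 (e i ω)]⟩
  have hc0 : ∀ i, ∫ ω, (h (e i ω) - q) ∂P = 0 := fun i => by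
    have hint : Integrable (fun ω => h (e i ω)) P :=
      integrable_of_abs_le (hh.comp (he i)) (K := 1) fun ω => by
        rw [abs_of_nonneg (hh0 _)]; exact hh1 _
    rw [integral_sub hint (integrable_const _), hq]
    simp
  have hb0 : ∀ i, ∫ ω, (g (e i ω) - p) ∂P = 0 := fun i => by
    have hint : Integrable (fun ω => g (e i ω)) P :=
      integrable_of_abs_le (hg.comp (he i)) (K := 1) fun ω => by
        rw [abs_of_nonneg (hg0 _)]; exact hg1 _
    rw [integral_sub hint (integrable_const _), hp]
    simp
  have hcind : iIndepFun (fun i ω => h (e i ω) - q) P :=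
    hiind.comp (fun _ t => h t - q) fun _ => hh.sub_const q
  have hbind : iIndepFun (fun i ω => g (e i ω) - p) P :=
    hiind.comp (fun _ t => g t - p) fun _ => hg.sub_const p
  have hgvec : Measurable fun (t : Fin n → ℝ) (i : Fin n) => g (t i) - p :=
    measurable_pi_lambda _ fun i => (hg.comp (measurable_pi_apply i)).sub_const p
  have hhvec : Measurable fun (t : Fin n → ℝ) (i : Fin n) => h (t i) - q :=
    measurable_pi_lambda _ fun i => (hh.comp (measurable_pi_apply i)).sub_const q
  have hn0 : (0 : ℝ) ≤ n := Nat.cast_nonneg n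
  have hsq : √(n : ℝ) ^ 2 = n := Real.sq_sqrt hn0
  have hs0 : 0 ≤ √(n : ℝ) := Real.sqrt_nonneg _
  have b1 : ∀ i, Integrable (fun ω => |∑ j, W i j (fun l => x l ω) * (h (e j ω) - q)|) P ∧
      ∫ ω, |∑ j, W i j (fun l => x l ω) * (h (e j ω) - q)| ∂P ≤ 2 * √n := by
    intro i
    refine integral_abs_sum_mul_le_of_iIndepFun (C := fun j ω => W i j (fun l => x l ω))
      (b := fun j ω => h (e j ω) - q) (K := 1)
      (fun j => (hW i j).comp hX) hcm (fun j ω => ?_) hc1 hc0 hcind ?_ (by positivity) ?_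
    · rw [abs_of_nonneg (hW0 _ _ _)]; exact hW1 _ _ _
    · exact hind.comp (φ := fun z j => W i j z) (measurable_pi_lambda _ fun j => hW i j) hhvec
    · refine ae_of_all _ fun ω => ?_
      have : ∑ j, W i j (fun l => x l ω) ^ 2 ≤ ∑ _j : Fin n, (1 : ℝ) :=
        Finset.sum_le_sum fun j _ => pow_le_one₀ (hW0 _ _ _) (hW1 _ _ _)
      simp only [Finset.sum_const, Finset.card_univ, Fintype.card_fin, nsmul_eq_mul,
        mul_one] at this
      rw [mul_pow, hsq]
      linarith
  have b2 : Integrable (fun ω => |∑ i, V i (fun l => x l ω) * (g (e i ω) - p)|) P ∧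
      ∫ ω, |∑ i, V i (fun l => x l ω) * (g (e i ω) - p)| ∂P ≤ 2 * (n * √n) := by
    refine integral_abs_sum_mul_le_of_iIndepFun (C := fun i ω => V i (fun l => x l ω))
      (b := fun j ω => g (e j ω) - p) (K := n)
      (fun j => (hVm j).comp hX) hbm (fun j ω => ?_) hb1 hb0 hbind ?_ (by positivity) ?_
    · rw [abs_of_nonneg (hV0 _ _)]; exact hVn _ _
    · exact hind.comp (φ := fun z j => V j z) (measurable_pi_lambda _ fun j => hVm j) hgvec
    · refine ae_of_all _ fun ω => ?_
      have : ∑ i, V i (fun l => x l ω) ^ 2 ≤ ∑ _j : Fin n, (n : ℝ) ^ 2 :=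
        Finset.sum_le_sum fun j _ => hVsq _ _
      simp only [Finset.sum_const, Finset.card_univ, Fintype.card_fin, nsmul_eq_mul] at this
      rw [mul_pow, mul_pow, hsq]
      nlinarith [pow_nonneg hn0 3]
  have b3 : Integrable (fun ω => |∑ m, (∑ i, if M ω i = m then V i (fun l => x l ω) else 0) *
      (g (e m ω) - p)|) P ∧ ∫ ω, |∑ m, (∑ i, if M ω i = m then V i (fun l => x l ω) else 0) *
      (g (e m ω) - p)| ∂P ≤ 3 * (n * √n) := by
    refine integral_abs_sum_mul_le_of_iIndepFun
      (C := fun m ω => ∑ i, if M ω i = m then V i (fun l => x l ω) else 0)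
      (b := fun j ω => g (e j ω) - p) (K := ∑ _i : Fin n, (n : ℝ))
      (fun m => Finset.measurable_sum _ fun i _ => Measurable.ite (hMset i m)
        ((hVm i).comp hX) measurable_const) hbm (fun m ω => ?_) hb1 hb0 hbind ?_
      (by positivity) ?_
    · refine (Finset.abs_sum_le_sum_abs _ _).trans (Finset.sum_le_sum fun i _ => ?_)
      split_ifs
      · rw [abs_of_nonneg (hV0 _ _)]; exact hVn _ _
      · simp
    · have := hind.comp (φ := fun z m => ∑ i, if z ∈ A i m then V i z else 0)
        (measurable_pi_lambda _ fun m => Finset.measurable_sum _ fun i _ =>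
          Measurable.ite (hA i m) (hVm i) measurable_const) hgvec
      refine this.congr ?_ (ae_eq_refl _)
      filter_upwards [hMA] with ω hω
      ext m
      exact Finset.sum_congr rfl fun i _ => by simp [hω]
    -- The fibre bound enters here: each coefficient is at most 2n, and 2 · n · (2n)² = 8n³ ≤ (3 n
    -- √n)².
    · filter_upwards [hfib] with ω hω
      have : ∑ m, (∑ i, if M ω i = m then V i (fun l => x l ω) else 0) ^ 2 ≤
          ∑ _m : Fin n, (2 * (n : ℝ)) ^ 2 := by
        refine Finset.sum_le_sum fun m _ => pow_le_pow_left₀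
          (Finset.sum_nonneg fun i _ => by split_ifs; exacts [hV0 _ _, le_rfl]) ?_ 2
        rw [← Finset.sum_filter]
        calc _ ≤ ∑ _i ∈ Finset.univ.filter (fun i => M ω i = m), (n : ℝ) :=
              Finset.sum_le_sum fun i _ => hVn _ _
          _ ≤ 2 * n := by
              rw [Finset.sum_const, nsmul_eq_mul]
              exact mul_le_mul_of_nonneg_right (by exact_mod_cast hω m) hn0
      simp only [Finset.sum_const, Finset.card_univ, Fintype.card_fin, nsmul_eq_mul] at this
      rw [mul_pow, mul_pow, hsq]
      nlinarith [pow_nonneg hn0 3]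
  have b4 : Integrable (fun ω => |∑ a : Fin n × Fin n,
      (if M ω a.1 = a.2 then V a.1 (fun l => x l ω) else 0) *
      (if a.1 = a.2 then 0 else (g (e a.1 ω) - p) * (g (e a.2 ω) - p))|) P ∧ ∫ ω, |∑ a : Fin n × Fin n, (if M ω a.1 = a.2 then V a.1 (fun l => x l ω) else 0) *
      (if a.1 = a.2 then 0 else (g (e a.1 ω) - p) * (g (e a.2 ω) - p))| ∂P ≤ 2 * (n * √n) := by
    refine integral_abs_sum_mul_pair_le_of_iIndepFun
      (C := fun a ω => if M ω a.1 = a.2 then V a.1 (fun l => x l ω) else 0)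
      (b := fun j ω => g (e j ω) - p) (K := n)
      (fun a => Measurable.ite (hMset _ _) ((hVm _).comp hX) measurable_const) hbm
      (fun a ω => ?_) hb1 hb0 hbind ?_ (by positivity) ?_
    · split_ifs
      · rw [abs_of_nonneg (hV0 _ _)]; exact hVn _ _
      · simp
    · have := hind.comp (φ := fun z (a : Fin n × Fin n) => if z ∈ A a.1 a.2 then V a.1 z else 0)
        (measurable_pi_lambda _ fun a =>
          Measurable.ite (hA _ _) (hVm _) measurable_const) hgvec
      refine this.congr ?_ (ae_eq_refl _)
      filter_upwards [hMA] with ω hω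
      ext a
      simp [hω]
    · refine ae_of_all _ fun ω => ?_
      have : ∑ a : Fin n × Fin n, (if M ω a.1 = a.2 then V a.1 (fun l => x l ω) else 0) ^ 2 ≤
          ∑ _m : Fin n, (n : ℝ) ^ 2 := by
        rw [Fintype.sum_prod_type]
        refine Finset.sum_le_sum fun i _ => ?_
        rw [Finset.sum_eq_single_of_mem (M ω i) (Finset.mem_univ _)
          fun m _ hm => by rw [if_neg (Ne.symm hm)]; norm_num]
        rw [if_pos rfl]
        exact hVsq _ _
      simp only [Finset.sum_const, Finset.card_univ, Fintype.card_fin, nsmul_eq_mul] at this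
      rw [mul_pow, mul_pow, hsq]
      nlinarith [pow_nonneg hn0 3]
  -- The constant 9 is 2 + 2 + 3 + 2, the first 2 after summing 2√n over the n rows.
  have i1 := integrable_finsetSum (Finset.univ : Finset (Fin n)) fun i _ => (b1 i).1
  refine ⟨_, ((i1.add b2.1).add b3.1).add b4.1, ?_, ?_⟩
  · filter_upwards [hMne] with ω hω
    exact abs_trilinear_sum_sub_le hω hq0 hq1 hp0 hp1 (h := fun j => h (e j ω))
      (g := fun j => g (e j ω)) (W := fun i j => W i j (fun l => x l ω))
      (fun i => hg0 _) (fun i => hg1 _)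
  · have e1 := integral_add ((i1.add b2.1).add b3.1) b4.1
    have e2 := integral_add (i1.add b2.1) b3.1
    have e3 := integral_add i1 b2.1
    have e4 : ∫ ω, ∑ i, |∑ j, W i j (fun l => x l ω) * (h (e j ω) - q)| ∂P ≤ n * (2 * √n) := by
      rw [integral_finsetSum _ fun i _ => (b1 i).1]
      refine (Finset.sum_le_sum fun i _ => (b1 i).2).trans_eq ?_
      simp
    simp only [Pi.add_apply] at e1 e2 e3 ⊢
    rw [e1, e2, e3]
    linarith [b2.2, b3.2, b4.2]

end Trilinear

/-! ### Mean and concentration of the lexicographic count. -/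

theorem sum_sum_ite_le_eq {n : ℕ} {w : Fin n → ℝ} (hw : Function.Injective w) :
    ∑ i, ∑ j, (if w j ≤ w i then (1 : ℝ) else 0) = n * (n + 1) / 2 := by
  rw [Finset.sum_comm]
  have := sum_card_filter_le Finset.univ w hw.injOn (fun l => (l : ℝ))
  simp only [Finset.card_univ, Fintype.card_fin] at this
  rw [sum_range_succ_cast] at this
  rw [← this]
  exact Finset.sum_congr rfl fun i _ => by simp [Finset.sum_boole]

theorem sum_sum_ite_lt_eq {n : ℕ} {w : Fin n → ℝ} (hw : Function.Injective w) :
    ∑ i, ∑ j, (if w i < w j then (1 : ℝ) else 0) = n * (n - 1) / 2 := by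
  have h : ∀ i j, (if w i < w j then (1 : ℝ) else 0) = 1 - if w j ≤ w i then (1 : ℝ) else 0 := by
    intro i j
    split_ifs <;> grind
  simp_rw [h, Finset.sum_sub_distrib]
  rw [sum_sum_ite_le_eq hw]
  simp
  ring

theorem card_filter_lt_eq (S : Finset ℝ) {s : ℝ} (hs : s ∈ S) :
    ((S.filter fun t => s < t).card : ℝ) = (S.filter fun t => s ≤ t).card - 1 := by
  have : S.filter (fun t => s ≤ t) = insert s (S.filter fun t => s < t) := by
    ext t
    simp only [Finset.mem_filter, Finset.mem_insert]
    grind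
  rw [this, Finset.card_insert_of_notMem (by simp)]
  push_cast
  ring

/-- The limiting value of `lexCount / n ^ 2`, up to an explicit error. -/
theorem sum_lexCount_mean {n k : ℕ} (hn : n ≠ 0) (hk : k ≠ 0) (S : Finset ℝ) (hS : S.card = k) :
    (∑ s ∈ S, (1 / k * ((S.filter fun t => s < t).card / (k : ℝ)) ^ 2 * (n * (n - 1) / 2) +
      1 / k * ((S.filter fun t => s ≤ t).card / (k : ℝ)) ^ 2 * (n * (n + 1) / 2))) / (n : ℝ) ^ 2 =
      (2 * (k : ℝ) ^ 2 + 1) / (6 * k ^ 2) + 1 / (2 * n * k) := by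
  have h1 : ∑ s ∈ S, ((S.filter fun t => s ≤ t).card : ℝ) = k * (k + 1) / 2 := by
    have := sum_card_filter_le S id Function.injective_id.injOn (fun l => (l : ℝ))
    rw [sum_range_succ_cast, hS] at this
    exact this
  have h2 : ∑ s ∈ S, ((S.filter fun t => s ≤ t).card : ℝ) ^ 2 = k * (k + 1) * (2 * k + 1) / 6 := by
    have := sum_card_filter_le S id Function.injective_id.injOn (fun l => (l : ℝ) ^ 2)
    rw [sum_range_succ_cast_sq, hS] at this
    exact this
  have hn' : (n : ℝ) ≠ 0 := by exact_mod_cast hn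
  have hk' : (k : ℝ) ≠ 0 := by exact_mod_cast hk
  have e : ∀ s ∈ S, 1 / k * ((S.filter fun t => s < t).card / (k : ℝ)) ^ 2 * (n * (n - 1) / 2) +
      1 / k * ((S.filter fun t => s ≤ t).card / (k : ℝ)) ^ 2 * (n * (n + 1) / 2) =
      (n : ℝ) ^ 2 / k ^ 3 * ((S.filter fun t => s ≤ t).card : ℝ) ^ 2 -
        n * (n - 1) / k ^ 3 * (S.filter fun t => s ≤ t).card + n * (n - 1) / (2 * k ^ 3) := by
    intro s hs
    rw [card_filter_lt_eq S hs]
    field_simp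
    ring
  rw [Finset.sum_congr rfl e, Finset.sum_add_distrib, Finset.sum_sub_distrib, ← Finset.mul_sum,
    ← Finset.mul_sum, h1, h2, Finset.sum_const, hS, nsmul_eq_mul]
  field_simp
  ring

section LexCount

variable {Ω : Type*} [MeasurableSpace Ω] {P : Measure Ω} [IsProbabilityMeasure P]

theorem exists_integrable_abs_lexCount_sub_le {n k : ℕ} (hn : n ≠ 0) (hk : k ≠ 0)
    {S : Finset ℝ} (hS : S.card = k)
    {x e : Fin n → Ω → ℝ} {M : Ω → Fin n → Fin n}
    (hx : ∀ i, Measurable (x i)) (he : ∀ i, Measurable (e i))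
    (hM : ∀ i, Measurable fun ω => M ω i)
    (hind : IndepFun (fun ω i => x i ω) (fun ω i => e i ω) P) (hiind : iIndepFun e P)
    (heS : ∀ᵐ ω ∂P, ∀ i, e i ω ∈ S)
    (heint : ∀ i (f : ℝ → ℝ), Measurable f → ∫ ω, f (e i ω) ∂P = (∑ s ∈ S, f s) / k)
    (hxinj : ∀ᵐ ω ∂P, Function.Injective fun i => x i ω)
    {A : Fin n → Fin n → Set (Fin n → ℝ)} (hA : ∀ i m, MeasurableSet (A i m))
    (hMA : ∀ᵐ ω ∂P, ∀ i m, M ω i = m ↔ (fun l => x l ω) ∈ A i m)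
    (hMne : ∀ᵐ ω ∂P, ∀ i, M ω i ≠ i)
    (hfib : ∀ᵐ ω ∂P, ∀ m, (Finset.univ.filter fun i => M ω i = m).card ≤ 2)
    {σ : ℝ} (hσ : σ ≠ 0) :
    ∃ F : Ω → ℝ, Integrable F P ∧ (∀ᵐ ω ∂P,
      |lexCount (fun i => e i ω) (fun i => σ * x i ω) (M ω) / n ^ 2 -
        (2 * (k : ℝ) ^ 2 + 1) / (6 * k ^ 2)| ≤ F ω) ∧
      ∫ ω, F ω ∂P ≤ 18 * k / √n + 1 / n := by
  classical
  have hk1 : (1 : ℝ) ≤ k := by exact_mod_cast Nat.one_le_iff_ne_zero.2 hk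
  have hk0 : (0 : ℝ) < k := by linarith
  have hn1 : (1 : ℝ) ≤ n := by exact_mod_cast Nat.one_le_iff_ne_zero.2 hn
  have hn0 : (0 : ℝ) < n := by linarith
  have hmain : ∀ s ∈ S, ∀ U : Set ℝ, MeasurableSet U → ∀ W : Fin n → Fin n → (Fin n → ℝ) → ℝ,
      (∀ i j, Measurable (W i j)) → (∀ i j z, 0 ≤ W i j z) → (∀ i j z, W i j z ≤ 1) →
      ∃ F : Ω → ℝ, Integrable F P ∧ (∀ᵐ ω ∂P,
        |∑ i, ∑ j, (if e j ω = s then (1 : ℝ) else 0) * (if e i ω ∈ U then (1 : ℝ) else 0) *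
          (if e (M ω i) ω ∈ U then (1 : ℝ) else 0) * W i j (fun l => x l ω) -
        1 / k * ((S.filter fun t => t ∈ U).card / (k : ℝ)) ^ 2 *
          ∑ i, ∑ j, W i j (fun l => x l ω)| ≤ F ω) ∧
        ∫ ω, F ω ∂P ≤ 9 * (n * √n) := by
    intro s hs U hU W hW hW0 hW1
    refine exists_integrable_abs_trilinear_sub_le hx he hM hind hiind hA hMA hMne hfib
      (h := fun t => if t = s then (1 : ℝ) else 0) (g := fun t => if t ∈ U then (1 : ℝ) else 0)
      (Measurable.ite (measurableSet_singleton s) measurable_const measurable_const)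
      (Measurable.ite hU measurable_const measurable_const)
      (fun t => by split_ifs <;> norm_num) (fun t => by split_ifs <;> norm_num)
      (fun t => by split_ifs <;> norm_num) (fun t => by split_ifs <;> norm_num)
      (fun i => ?_) (fun i => ?_) (by positivity) ?_ (by positivity) ?_ hW hW0 hW1
    · rw [heint i (fun t => if t = s then (1 : ℝ) else 0)
        (Measurable.ite (measurableSet_singleton s) measurable_const measurable_const)]
      simp [hs]
    · rw [heint i (fun t => if t ∈ U then (1 : ℝ) else 0)
        (Measurable.ite hU measurable_const measurable_const)]
      simp [Finset.sum_boole]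
    · rw [div_le_one hk0]; exact hk1
    · rw [div_le_one hk0]
      rw [← hS]
      exact_mod_cast Finset.card_filter_le _ _
  have hmul : ∀ i, Measurable fun z : Fin n → ℝ => σ * z i := fun i => by fun_prop
  have h1 := fun s (hs : s ∈ S) => hmain s hs (Set.Ioi s) measurableSet_Ioi
    (fun i j z => if σ * z i < σ * z j then 1 else 0)
    (fun i j => Measurable.ite (measurableSet_lt (hmul i) (hmul j)) measurable_const measurable_const)
    (fun i j z => by split_ifs <;> norm_num) (fun i j z => by split_ifs <;> norm_num)
  have h2 := fun s (hs : s ∈ S) => hmain s hs (Set.Ici s) measurableSet_Ici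
    (fun i j z => if σ * z j ≤ σ * z i then 1 else 0)
    (fun i j => Measurable.ite (measurableSet_le (hmul j) (hmul i)) measurable_const measurable_const)
    (fun i j z => by split_ifs <;> norm_num) (fun i j z => by split_ifs <;> norm_num)
  choose! F1 hF1 hF1le hF1int using h1
  choose! F2 hF2 hF2le hF2int using h2
  have hF12 : Integrable (fun ω => ∑ s ∈ S, (F1 s ω + F2 s ω)) P :=
    integrable_finsetSum _ fun s hs => (hF1 s hs).add (hF2 s hs)
  refine ⟨fun ω => (∑ s ∈ S, (F1 s ω + F2 s ω)) / n ^ 2 + 1 / n,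
    (hF12.div_const _).add (integrable_const _), ?_, ?_⟩
  · filter_upwards [(Filter.eventually_all_finset S).2 hF1le,
      (Filter.eventually_all_finset S).2 hF2le, heS, hxinj] with ω ha hb hs hinj
    have hw : Function.Injective fun i => σ * x i ω := fun i j hij =>
      hinj (mul_left_cancel₀ hσ hij)
    simp only [Set.mem_Ioi, sum_sum_ite_lt_eq hw] at ha
    simp only [Set.mem_Ici, sum_sum_ite_le_eq hw] at hb
    have hmean := sum_lexCount_mean hn hk S hS
    rw [eq_comm, ← eq_sub_iff_add_eq] at hmean
    -- The exact centring differs from the limit by 1/(2nk), which is absorbed in the summand 1/n of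
    -- the bound.
    rw [hmean, lexCount_eq S hs, sub_sub_eq_add_sub, add_sub_right_comm, ← sub_div,
      ← Finset.sum_sub_distrib]
    refine (abs_add_le _ _).trans (add_le_add ?_ ?_)
    · rw [abs_div, abs_of_pos (by positivity : (0 : ℝ) < n ^ 2)]
      refine div_le_div_of_nonneg_right ?_ (by positivity)
      refine (Finset.abs_sum_le_sum_abs _ _).trans (Finset.sum_le_sum fun s hs => ?_)
      rw [add_sub_add_comm]
      exact (abs_add_le _ _).trans (add_le_add (ha s hs) (hb s hs))
    · rw [abs_of_pos (by positivity)]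
      refine one_div_le_one_div_of_le hn0 ?_
      nlinarith
  · have e1 : ∫ ω, ((∑ s ∈ S, (F1 s ω + F2 s ω)) / n ^ 2 + 1 / n) ∂P =
        (∑ s ∈ S, ((∫ ω, F1 s ω ∂P) + ∫ ω, F2 s ω ∂P)) / n ^ 2 + 1 / n := by
      have hsum : ∫ ω, ∑ s ∈ S, (F1 s ω + F2 s ω) ∂P =
          ∑ s ∈ S, ((∫ ω, F1 s ω ∂P) + ∫ ω, F2 s ω ∂P) :=
        (integral_finsetSum S fun s hs => (hF1 s hs).add (hF2 s hs)).trans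
          (Finset.sum_congr rfl fun s hs => integral_add (hF1 s hs) (hF2 s hs))
      rw [integral_add (hF12.div_const _) (integrable_const _), integral_div, hsum]
      simp
    rw [e1]
    refine add_le_add ?_ le_rfl
    have hle : ∑ s ∈ S, ((∫ ω, F1 s ω ∂P) + ∫ ω, F2 s ω ∂P) ≤ k * (18 * (n * √n)) := by
      calc _ ≤ ∑ _s ∈ S, (18 * ((n : ℝ) * √n)) := Finset.sum_le_sum fun s hs => by
            linarith [hF1int s hs, hF2int s hs]
        _ = _ := by rw [Finset.sum_const, hS, nsmul_eq_mul]
    refine (div_le_div_of_nonneg_right hle (by positivity)).trans_eq ?_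
    have hs0 : 0 < √(n : ℝ) := Real.sqrt_pos.2 hn0
    have hsq : √(n : ℝ) ^ 2 = n := Real.sq_sqrt hn0.le
    rw [div_eq_div_iff (by positivity) hs0.ne']
    have : (k : ℝ) * (18 * (n * √n)) * √n = 18 * k * n * √n ^ 2 := by ring
    rw [this, hsq]
    ring

end LexCount

/-! ### Joint independence and almost sure general position. -/

section Independence

variable {Ω : Type*} [MeasurableSpace Ω] {P : Measure Ω} {x e : ℕ → Ω → ℝ}

theorem iIndepFun_fin_of_pairs (hind : iIndepFun (fun (p : ℕ × Bool) ω =>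
    cond p.2 (e p.1 ω) (x p.1 ω)) P) (n : ℕ) :
    iIndepFun (fun (p : Fin n × Bool) ω => cond p.2 (e p.1 ω) (x p.1 ω)) P :=
  hind.precomp (g := fun p : Fin n × Bool => ((p.1 : ℕ), p.2)) fun p q hpq => by
    simp only [Prod.mk.injEq] at hpq
    exact Prod.ext (Fin.ext hpq.1) hpq.2

theorem iIndepFun_fin_snd_of_pairs
    (hind : iIndepFun (fun (p : ℕ × Bool) ω => cond p.2 (e p.1 ω) (x p.1 ω)) P) (n : ℕ) :
    iIndepFun (fun (i : Fin n) => e i) P :=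
  hind.precomp (g := fun i : Fin n => ((i : ℕ), true)) fun i j hij => by
    simp only [Prod.mk.injEq] at hij
    exact Fin.ext hij.1

theorem indepFun_fin_of_pairs (hx : ∀ i, Measurable (x i)) (he : ∀ i, Measurable (e i))
    (hind : iIndepFun (fun (p : ℕ × Bool) ω => cond p.2 (e p.1 ω) (x p.1 ω)) P) (n : ℕ) :
    IndepFun (fun ω (i : Fin n) => x i ω) (fun ω (i : Fin n) => e i ω) P := by
  classical
  have h := (iIndepFun_fin_of_pairs hind n).indepFun_finset
    (Finset.univ.filter fun p => p.2 = false) (Finset.univ.filter fun p => p.2 = true)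
    (by
      rw [Finset.disjoint_filter]
      intro p _ h1 h2
      simp [h1] at h2) (fun p => by
      rcases p with ⟨i, b⟩
      cases b
      exacts [hx i, he i])
  have hf : ∀ i : Fin n, (i, false) ∈ (Finset.univ.filter fun p : Fin n × Bool => p.2 = false) :=
    fun i => by simp
  have ht : ∀ i : Fin n, (i, true) ∈ (Finset.univ.filter fun p : Fin n × Bool => p.2 = true) :=
    fun i => by simp
  have m1 : Measurable fun (c : (Finset.univ.filter fun p : Fin n × Bool => p.2 = false) → ℝ)
      (i : Fin n) => c ⟨(i, false), hf i⟩ :=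
    measurable_pi_lambda _ fun i => measurable_pi_apply _
  have m2 : Measurable fun (c : (Finset.univ.filter fun p : Fin n × Bool => p.2 = true) → ℝ)
      (i : Fin n) => c ⟨(i, true), ht i⟩ :=
    measurable_pi_lambda _ fun i => measurable_pi_apply _
  exact h.comp m1 m2

variable [IsProbabilityMeasure P]

/-- Together with independence across i, this flattens all x_i and e_i into one independent family
indexed by ℕ × Bool, from which any sub-block can be separated. -/
theorem iIndepFun_cond_of_indepFun {u v : Ω → ℝ} (hu : Measurable u) (hv : Measurable v)
    (h : IndepFun u v P) : iIndepFun (fun (b : Bool) ω => cond b (v ω) (u ω)) P := by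
  have hm : ∀ b : Bool, Measurable fun ω => cond b (v ω) (u ω) := fun b => by
    cases b
    exacts [hu, hv]
  rw [iIndepFun_iff_map_fun_eq_pi_map fun b => (hm b).aemeasurable]
  symm
  have : ∀ b : Bool, IsProbabilityMeasure (P.map fun ω => cond b (v ω) (u ω)) := fun b =>
    Measure.isProbabilityMeasure_map (hm b).aemeasurable
  refine Measure.pi_eq fun s hs => ?_
  rw [Measure.map_apply (measurable_pi_lambda _ hm) (MeasurableSet.univ_pi hs), Fintype.prod_bool,
    Measure.map_apply (hm _) (hs _), Measure.map_apply (hm _) (hs _), mul_comm]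
  have := h.measure_inter_preimage_eq_mul _ _ (hs false) (hs true)
  simp only [cond_true, cond_false]
  refine Eq.trans ?_ this
  congr 1
  ext ω
  simp

theorem iIndepFun_uncurry_of_pairs (hx : ∀ i, Measurable (x i))
    (he : ∀ i, Measurable (e i)) (hiid : iIndepFun (fun i ω => (x i ω, e i ω)) P)
    (hxe : ∀ i, IndepFun (x i) (e i) P) :
    iIndepFun (fun (p : ℕ × Bool) ω => cond p.2 (e p.1 ω) (x p.1 ω)) P := by
  refine iIndepFun_uncurry' (X := fun i (b : Bool) ω => cond b (e i ω) (x i ω))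
    (fun i b => ?_) ?_ fun i => iIndepFun_cond_of_indepFun (hx i) (he i) (hxe i)
  · cases b
    exacts [hx i, he i]
  · refine hiid.comp (fun _ (p : ℝ × ℝ) (b : Bool) => cond b p.2 p.1) fun _ =>
      measurable_pi_lambda _ fun b => ?_
    cases b
    exacts [measurable_fst, measurable_snd]

/-- A variable of a finite independent family with a continuous distribution almost surely differs
from any measurable function of the remaining variables. -/
theorem ae_ne_of_iIndepFun {ι : Type*} [Fintype ι] [DecidableEq ι] {Z : ι → Ω → ℝ}
    (hZ : ∀ p, Measurable (Z p)) (h : iIndepFun Z P) (p : ι)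
    (hp : ∀ a, P (Z p ⁻¹' {a}) = 0) {G : (ι → ℝ) → ℝ} (hG : Measurable G) :
    ∀ᵐ ω ∂P, Z p ω ≠ G (Function.update (fun q => Z q ω) p 0) := by
  have hupd : Measurable fun (c : ↥(Finset.univ.erase p : Finset ι) → ℝ) (q : ι) =>
      if hq : q = p then (0 : ℝ) else c ⟨q, Finset.mem_erase.2 ⟨hq, Finset.mem_univ q⟩⟩ := by
    refine measurable_pi_lambda _ fun q => ?_
    by_cases hq : q = p
    · simp only [hq, dite_true]
      exact measurable_const
    · simp only [hq, dite_false]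
      exact measurable_pi_apply _
  have hpp : p ∈ ({p} : Finset ι) := by simp
  have hm0 : Measurable fun c : ({p} : Finset ι) → ℝ => c ⟨p, hpp⟩ := measurable_pi_apply _
  have hi := (h.indepFun_finset {p} (Finset.univ.erase p) (by simp) hZ).comp hm0 (hG.comp hupd)
  set T : Ω → ℝ := fun ω => G (Function.update (fun q => Z q ω) p 0) with hT
  have hTm : Measurable T := by
    refine hG.comp (measurable_pi_lambda _ fun q => ?_)
    by_cases hq : q = p
    · subst hq
      simp only [Function.update_self]
      exact measurable_const
    · simp only [Function.update_of_ne hq]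
      exact hZ q
  have hi' : IndepFun (T) (Z p) P := by
    refine IndepFun.symm ?_
    convert! hi using 1
    ext ω
    simp only [hT, Function.comp]
    congr 1
    ext q
    by_cases hq : q = p
    · subst hq
      simp
    · simp [hq]
  -- Overwriting the coordinate p by 0 makes T a function of the other variables. The joint law is
  -- then a product, and by Fubini the diagonal is null because every vertical section is an atom of
  -- `Z p`.
  have hmap := hi'.map_prod_eq_prod_map_map hTm.aemeasurable (hZ p).aemeasurable
  have hdiag : MeasurableSet {r : ℝ × ℝ | r.2 = r.1} :=
    measurableSet_eq_fun measurable_snd measurable_fst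
  have hzero : P.map (fun ω => (T ω, Z p ω)) {r : ℝ × ℝ | r.2 = r.1} = 0 := by
    rw [hmap, Measure.measure_prod_null hdiag]
    refine ae_of_all _ fun t => ?_
    change P.map (Z p) (Prod.mk t ⁻¹' _) = 0
    rw [Measure.map_apply (hZ p) (measurable_prodMk_left hdiag)]
    exact hp t
  rw [Measure.map_apply (hTm.prodMk (hZ p)) hdiag] at hzero
  rw [ae_iff]
  simpa using hzero

theorem ae_ne_of_pairs (hx : ∀ i, Measurable (x i)) (he : ∀ i, Measurable (e i))
    (hind : iIndepFun (fun (p : ℕ × Bool) ω => cond p.2 (e p.1 ω) (x p.1 ω)) P)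
    (hatom : ∀ i a, P (x i ⁻¹' {a}) = 0) {n : ℕ} (i : Fin n)
    {G : (Fin n → ℝ) → (Fin n → ℝ) → ℝ} (hG : Measurable (Function.uncurry G)) :
    ∀ᵐ ω ∂P, x i ω ≠ G (Function.update (fun j => x j ω) i 0) (fun j => e j ω) := by
  have h := ae_ne_of_iIndepFun (P := P)
    (Z := fun (p : Fin n × Bool) ω => cond p.2 (e p.1 ω) (x p.1 ω))
    (fun p => by
      rcases p with ⟨i, b⟩
      cases b
      exacts [hx i, he i]) (iIndepFun_fin_of_pairs hind n) (i, false) (hatom i)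
    (G := fun c => G (fun j => c (j, false)) (fun j => c (j, true)))
    (hG.comp (Measurable.prodMk (measurable_pi_lambda _ fun j => measurable_pi_apply _)
      (measurable_pi_lambda _ fun j => measurable_pi_apply _)))
  filter_upwards [h] with ω hω
  intro heq
  apply hω
  simp only [cond_false]
  refine heq.trans ?_
  congr 1
  · ext j
    by_cases hj : j = i
    · subst hj
      simp
    · have : (j, false) ≠ (i, false) := fun h => hj (Prod.mk.inj h).1
      rw [Function.update_of_ne hj, Function.update_of_ne this]
      rfl
  · ext j
    have : (j, true) ≠ (i, false) := by simp
    rw [Function.update_of_ne this]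
    rfl

theorem ae_injective_of_pairs (hx : ∀ i, Measurable (x i)) (he : ∀ i, Measurable (e i))
    (hind : iIndepFun (fun (p : ℕ × Bool) ω => cond p.2 (e p.1 ω) (x p.1 ω)) P)
    (hatom : ∀ i a, P (x i ⁻¹' {a}) = 0) (n : ℕ) :
    ∀ᵐ ω ∂P, Function.Injective fun i : Fin n => x i ω := by
  have h : ∀ᵐ ω ∂P, ∀ i j : Fin n, j ≠ i → x i ω ≠ x j ω := by
    refine ae_all_iff.2 fun i => ae_all_iff.2 fun j => ?_
    have := ae_ne_of_pairs hx he hind hatom i (G := fun z _ => z j)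
      ((measurable_pi_apply j).comp measurable_fst)
    filter_upwards [this] with ω hω hij
    rwa [Function.update_of_ne hij] at hω
  filter_upwards [h] with ω hω i j hij
  by_contra hne
  exact hω i j (Ne.symm hne) hij

/-- Almost surely no sample point is the reflection of another one at a third one, so nearest
neighbours are unique. -/
theorem ae_ne_reflection_of_pairs (hx : ∀ i, Measurable (x i)) (he : ∀ i, Measurable (e i))
    (hind : iIndepFun (fun (p : ℕ × Bool) ω => cond p.2 (e p.1 ω) (x p.1 ω)) P)
    (hatom : ∀ i a, P (x i ⁻¹' {a}) = 0) (n : ℕ) :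
    ∀ᵐ ω ∂P, ∀ l i j : Fin n, i ≠ l → j ≠ l → x l ω ≠ 2 * x i ω - x j ω := by
  refine ae_all_iff.2 fun l => ae_all_iff.2 fun i => ae_all_iff.2 fun j => ?_
  have hG : Measurable (Function.uncurry fun (z _ : Fin n → ℝ) => 2 * z i - z j) := by
    unfold Function.uncurry
    fun_prop
  filter_upwards [ae_ne_of_pairs hx he hind hatom l hG] with ω hω hi hj
  rwa [Function.update_of_ne hi, Function.update_of_ne hj] at hω

/-- If e_i ≠ 0, the vanishing of the sum determines x_i from the other variables, an event of
probability zero. This makes the slope error nonzero. -/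
theorem ae_sum_mul_ne_zero_of_pairs (hx : ∀ i, Measurable (x i)) (he : ∀ i, Measurable (e i))
    (hind : iIndepFun (fun (p : ℕ × Bool) ω => cond p.2 (e p.1 ω) (x p.1 ω)) P)
    (hatom : ∀ i a, P (x i ⁻¹' {a}) = 0) (n : ℕ) :
    ∀ᵐ ω ∂P, ∀ i : Fin n, e i ω ≠ 0 → ∑ j : Fin n, x j ω * e j ω ≠ 0 := by
  classical
  refine ae_all_iff.2 fun i => ?_
  have hG : Measurable (Function.uncurry fun (z t : Fin n → ℝ) => -(∑ j, z j * t j) / t i) := by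
    unfold Function.uncurry
    fun_prop
  filter_upwards [ae_ne_of_pairs hx he hind hatom i hG] with ω hω hi hsum
  apply hω
  have h1 := Finset.add_sum_erase Finset.univ (fun j : Fin n => x j ω * e j ω) (Finset.mem_univ i)
  have h2 := Finset.add_sum_erase Finset.univ
    (fun j : Fin n => Function.update (fun j : Fin n => x j ω) i 0 j * e j ω) (Finset.mem_univ i)
  have h3 : ∑ j ∈ Finset.univ.erase i, Function.update (fun j : Fin n => x j ω) i 0 j * e j ω =
      ∑ j ∈ Finset.univ.erase i, x j ω * e j ω := Finset.sum_congr rfl fun j hj => by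
    rw [Function.update_of_ne (Finset.ne_of_mem_erase hj)]
  simp only [Function.update_self, zero_mul, zero_add] at h2
  rw [eq_div_iff hi, ← h2, h3]
  linarith

end Independence

/-! ### Nearest neighbours as a function of the sample; the population coefficient. -/

/-- The set of `z` for which `m` is a nearest neighbour of `i`. -/
def nearestNeighbourSet {n : ℕ} (i m : Fin n) : Set (Fin n → ℝ) :=
  {z | m ≠ i ∧ ∀ j, j ≠ i → |z m - z i| ≤ |z j - z i|}

theorem measurableSet_nearestNeighbourSet {n : ℕ} (i m : Fin n) :
    MeasurableSet (nearestNeighbourSet i m) := by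
  unfold nearestNeighbourSet
  refine (MeasurableSet.const _).inter ?_
  have : {z : Fin n → ℝ | ∀ j, j ≠ i → |z m - z i| ≤ |z j - z i|} =
      ⋂ j, {z | j ≠ i → |z m - z i| ≤ |z j - z i|} := by
    ext; simp
  change MeasurableSet {z : Fin n → ℝ | ∀ j, j ≠ i → |z m - z i| ≤ |z j - z i|}
  rw [this]
  refine MeasurableSet.iInter fun j => ?_
  by_cases hj : j = i
  · simp [hj]
  · simp only [ne_eq, hj, not_false_eq_true, forall_const]
    exact measurableSet_le (by fun_prop) (by fun_prop)

/-- Two distinct nearest neighbours of `z i` would be reflections of each other at `z i`, which is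
excluded. Hence any tie-breaking rule, even one using the errors, yields a function of z. -/
theorem IsNearestNeighbourMap.eq_iff_mem {n : ℕ} {z : Fin n → ℝ} {M : Fin n → Fin n}
    (hM : IsNearestNeighbourMap z M) (hz : Function.Injective z)
    (hrefl : ∀ l i j : Fin n, i ≠ l → j ≠ l → z l ≠ 2 * z i - z j) (i m : Fin n) :
    M i = m ↔ z ∈ nearestNeighbourSet i m := by
  constructor
  · rintro rfl
    exact hM i
  · rintro ⟨hmi, hm⟩
    by_contra hne
    have h1 := hm (M i) (hM i).1
    have h2 := (hM i).2 m hmi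
    have h3 : z (M i) ≠ z m := fun h => hne (hz h)
    have h4 := hrefl (M i) i m (hM i).1.symm (Ne.symm hne)
    rcases abs_eq_abs.1 (le_antisymm h1 h2) with h | h
    · exact h3 (by linarith)
    · exact h4 (by linarith)

/-- By independence the conditional probabilities are almost surely constant, so every variance in
the numerator vanishes. -/
theorem acT_eq_zero_of_indepFun {Ω : Type*} [MeasurableSpace Ω] (μ : Measure Ω)
    [IsProbabilityMeasure μ] {E X : Ω → ℝ} (hE : Measurable E) (hX : Measurable X)
    (h : IndepFun X E μ) : acT μ E X = 0 := by
  have hv : ∀ t : ℝ, Var[μ[{ω | t ≤ E ω}.indicator (fun _ => (1 : ℝ)) |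
      MeasurableSpace.comap X inferInstance]; μ] = 0 := by
    intro t
    have hs : MeasurableSet[MeasurableSpace.comap E inferInstance] {ω | t ≤ E ω} :=
      ⟨Set.Ici t, measurableSet_Ici, rfl⟩
    have hc := condExp_indep_eq (μ := μ) hE.comap_le hX.comap_le
      (f := {ω | t ≤ E ω}.indicator (fun _ => (1 : ℝ)))
      (StronglyMeasurable.indicator stronglyMeasurable_const hs) h.symm
    rw [variance_congr hc]
    simp [variance, evariance]
  unfold acT
  simp only [hv, integral_zero, zero_div]

/-! ### The uniform error law and the order of the residuals. -/

section Uniform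

variable {Ω : Type*} [MeasurableSpace Ω] {μ : Measure Ω}

theorem integral_comp_of_isUniform_count {E : Ω → ℝ} (hE : Measurable E) {S : Finset ℝ}
    (hEunif : pdf.IsUniform E (S : Set ℝ) μ Measure.count) {f : ℝ → ℝ} (hf : Measurable f) :
    ∫ ω, f (E ω) ∂μ = (∑ s ∈ S, f s) / S.card := by
  rw [← integral_map hE.aemeasurable hf.aestronglyMeasurable, hEunif, ProbabilityTheory.cond,
    integral_smul_measure, Measure.count_apply_finset, setIntegral_finset S (by
      rw [← (S : Set ℝ).biUnion_of_singleton]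
      simp [integrableOn_finset_iUnion])]
  simp [measureReal_def, div_eq_inv_mul]

theorem ae_mem_of_isUniform_count {E : Ω → ℝ} (hE : Measurable E) {S : Finset ℝ}
    (hEunif : pdf.IsUniform E (S : Set ℝ) μ Measure.count) : ∀ᵐ ω ∂μ, E ω ∈ S := by
  have h : ∀ᵐ t ∂(μ.map E), t ∈ (S : Set ℝ) := by
    rw [hEunif]
    exact ae_cond_mem S.measurableSet
  exact ae_of_ae_map hE.aemeasurable h

end Uniform

/-- The residuals are ordered lexicographically as soon as the slope error is small and nonzero. -/
theorem add_mul_le_add_mul_iff {a b u v δ η C : ℝ} (hu : |u| ≤ C) (hv : |v| ≤ C)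
    (hab : a < b → η ≤ b - a) (hba : b < a → η ≤ a - b) (hδ : |δ| * (2 * C) < η) {σ : ℝ}
    (hσ : u * δ ≤ v * δ ↔ σ * u ≤ σ * v) :
    a + u * δ ≤ b + v * δ ↔ a < b ∨ (a = b ∧ σ * u ≤ σ * v) := by
  have h1 : |(u - v) * δ| < η := by
    rw [abs_mul]
    have : |u - v| ≤ 2 * C := (abs_sub _ _).trans (by linarith)
    nlinarith [abs_nonneg δ, mul_le_mul_of_nonneg_right this (abs_nonneg δ)]
  have h2 := abs_lt.1 h1
  rw [← hσ]
  constructor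
  · intro h
    rcases lt_trichotomy a b with hlt | heq | hgt
    · exact Or.inl hlt
    · exact Or.inr ⟨heq, by linarith⟩
    · exfalso
      have := hba hgt
      linarith
  · rintro (h | ⟨h, h'⟩)
    · have := hab h
      linarith
    · linarith

theorem exists_pos_le_sub_of_lt (S : Finset ℝ) :
    ∃ η > 0, ∀ a ∈ S, ∀ b ∈ S, a < b → η ≤ b - a := by
  classical
  set D := ((S ×ˢ S).filter fun p => p.1 < p.2).image fun p => p.2 - p.1 with hD
  by_cases h : D.Nonempty
  · refine ⟨D.min' h, ?_, fun a ha b hb hab => D.min'_le _ ?_⟩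
    · obtain ⟨p, hp, hpe⟩ := Finset.mem_image.1 (D.min'_mem h)
      rw [gt_iff_lt, ← hpe]
      exact sub_pos.2 (Finset.mem_filter.1 hp).2
    · exact Finset.mem_image.2 ⟨(a, b), Finset.mem_filter.2 ⟨Finset.mk_mem_product ha hb, hab⟩, rfl⟩
  · refine ⟨1, one_pos, fun a ha b hb hab => absurd ⟨b - a, ?_⟩ h⟩
    exact Finset.mem_image.2 ⟨(a, b), Finset.mem_filter.2 ⟨Finset.mk_mem_product ha hb, hab⟩, rfl⟩

/-! ### Passage to the limit, measurability, and consistency of least squares. -/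

/-- If `T n` is bounded and almost surely eventually within `G n` of `L`, where `∫ G n → 0`, then
`∫ T n → L`. -/
theorem tendsto_integral_of_eventually_abs_sub_le {Ω : Type*} [MeasurableSpace Ω] {P : Measure Ω}
    [IsProbabilityMeasure P] {T G : ℕ → Ω → ℝ} {K L : ℝ} (hT : ∀ n, Integrable (T n) P)
    (hTK : ∀ n, ∀ᵐ ω ∂P, |T n ω| ≤ K) (hG : ∀ n, Integrable (G n) P)
    (hG0 : ∀ n, ∀ᵐ ω ∂P, 0 ≤ G n ω) (hGlim : Tendsto (fun n => ∫ ω, G n ω ∂P) atTop (𝓝 0))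
    (h : ∀ᵐ ω ∂P, ∀ᶠ n in atTop, |T n ω - L| ≤ G n ω) :
    Tendsto (fun n => ∫ ω, T n ω ∂P) atTop (𝓝 L) := by
  -- The excess of |T n - L| over `G n` is almost surely eventually zero and bounded by K + |L|, so
  -- its integral tends to 0 by dominated convergence.
  set H : ℕ → Ω → ℝ := fun n ω => max 0 (|T n ω - L| - G n ω) with hH
  have hTL : ∀ n, Integrable (fun ω => |T n ω - L|) P := fun n =>
    ((hT n).sub (integrable_const L)).abs
  have hHi : ∀ n, Integrable (H n) P := fun n =>
    (integrable_const (0 : ℝ)).sup ((hTL n).sub (hG n))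
  have hHlim : Tendsto (fun n => ∫ ω, H n ω ∂P) atTop (𝓝 (∫ _ω, (0 : ℝ) ∂P)) := by
    refine tendsto_integral_of_dominated_convergence (fun _ => K + |L|) (fun n => (hHi n).1)
      (integrable_const _) (fun n => ?_) ?_
    · filter_upwards [hTK n, hG0 n] with ω h1 h2
      rw [Real.norm_eq_abs, abs_of_nonneg (le_max_left _ _)]
      have h3 : |T n ω - L| ≤ |T n ω| + |L| := abs_sub _ _
      exact max_le (by linarith [abs_nonneg (T n ω), abs_nonneg L]) (by linarith)
    · filter_upwards [h] with ω hω
      refine tendsto_const_nhds.congr' ?_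
      filter_upwards [hω] with n hn
      exact (max_eq_left (by linarith)).symm
  rw [integral_zero] at hHlim
  have hsum := hHlim.add hGlim
  rw [add_zero] at hsum
  rw [tendsto_iff_norm_sub_tendsto_zero]
  refine squeeze_zero (fun n => norm_nonneg _) (fun n => ?_) hsum
  have e : (∫ ω, T n ω ∂P) - L = ∫ ω, (T n ω - L) ∂P := by
    rw [integral_sub (hT n) (integrable_const L)]
    simp
  rw [e, ← integral_add (hHi n) (hG n)]
  refine (norm_integral_le_integral_norm _).trans
    (integral_mono (hTL n) ((hHi n).add (hG n)) fun ω => ?_)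
  simp only [hH, Real.norm_eq_abs]
  linarith [le_max_right 0 (|T n ω - L| - G n ω)]

theorem measurable_acTn {Ω : Type*} [MeasurableSpace Ω] {n : ℕ} {r : Fin n → Ω → ℝ}
    (hr : ∀ i, Measurable (r i)) {M : Ω → Fin n → Fin n} (hM : ∀ i, Measurable fun ω => M ω i) :
    Measurable fun ω => acTn (fun i => r i ω) (M ω) := by
  have hR : ∀ i, Measurable fun ω => (acR (fun i => r i ω) i : ℝ) := fun i => by
    simp only [acR_eq_sum]
    exact Finset.measurable_sum _ fun j _ =>
      Measurable.ite (measurableSet_le (hr j) (hr i)) measurable_const measurable_const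
  have hL : ∀ i, Measurable fun ω => (acL (fun i => r i ω) i : ℝ) := fun i => by
    simp only [acL_eq_sum]
    exact Finset.measurable_sum _ fun j _ =>
      Measurable.ite (measurableSet_le (hr i) (hr j)) measurable_const measurable_const
  have hRM : ∀ i, Measurable fun ω => (acR (fun i => r i ω) (M ω i) : ℝ) := fun i => by
    have : ∀ ω, (acR (fun i => r i ω) (M ω i) : ℝ) =
        ∑ m, if M ω i = m then (acR (fun i => r i ω) m : ℝ) else 0 := fun ω => by simp
    simp only [this]
    exact Finset.measurable_sum _ fun m _ =>
      Measurable.ite (hM i (measurableSet_singleton m)) (hR m) measurable_const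
  unfold acTn
  exact (Finset.measurable_sum _ fun i _ => ((measurable_const.mul ((hR i).min (hRM i))).sub
    ((hL i).pow_const 2))).div (Finset.measurable_sum _ fun i _ =>
      (hL i).mul (measurable_const.sub (hL i)))

theorem sum_range_sub_mul_eq (n : ℕ) (x y : ℕ → ℝ) (β : ℝ) :
    ∑ i ∈ Finset.range n, x i * (y i - x i * β) =
      ∑ i ∈ Finset.range n, x i * y i - β * ∑ i ∈ Finset.range n, x i ^ 2 := by
  rw [Finset.mul_sum, ← Finset.sum_sub_distrib]
  exact Finset.sum_congr rfl fun i _ => by ring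

theorem sub_lsSlope_eq (n : ℕ) (x y : ℕ → ℝ) (β : ℝ)
    (h : ∑ i ∈ Finset.range n, x i ^ 2 ≠ 0) :
    β - lsSlope n x y =
      -(∑ i ∈ Finset.range n, x i * (y i - x i * β)) / ∑ i ∈ Finset.range n, x i ^ 2 := by
  rw [sum_range_sub_mul_eq, lsSlope]
  field_simp
  ring

theorem lsResidual_eq (n : ℕ) (x y : ℕ → ℝ) (β : ℝ) (i : ℕ) :
    lsResidual n x y i = (y i - x i * β) + x i * (β - lsSlope n x y) := by
  rw [lsResidual]
  ring

section Model

variable {Ω : Type*} [MeasurableSpace Ω] {P : Measure Ω}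

/-- Strong law for bounded functions of an i.i.d. sequence of pairs. -/
theorem ae_tendsto_average {x e : ℕ → Ω → ℝ}
    (hiid : iIndepFun (fun i ω => (x i ω, e i ω)) P)
    (hid : ∀ i, IdentDistrib (fun ω => (x i ω, e i ω)) (fun ω => (x 0 ω, e 0 ω)) P P)
    {f : ℝ × ℝ → ℝ} (hf : Measurable f) (hint : Integrable (fun ω => f (x 0 ω, e 0 ω)) P) :
    ∀ᵐ ω ∂P, Tendsto (fun n : ℕ => (∑ i ∈ Finset.range n, f (x i ω, e i ω)) / n) atTop
      (𝓝 (∫ ω, f (x 0 ω, e 0 ω) ∂P)) :=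
  strong_law_ae_real (fun i ω => f (x i ω, e i ω)) hint
    (fun _ _ hij => (hiid.indepFun hij).comp hf hf) fun i => (hid i).comp hf

theorem ae_tendsto_sub_lsSlope {x y e : ℕ → Ω → ℝ} {β : ℝ}
    (heq : ∀ i ω, e i ω = y i ω - x i ω * β)
    (hiid : iIndepFun (fun i ω => (x i ω, e i ω)) P)
    (hid : ∀ i, IdentDistrib (fun ω => (x i ω, e i ω)) (fun ω => (x 0 ω, e 0 ω)) P P)
    (hxe : Integrable (fun ω => x 0 ω * e 0 ω) P) (hxx : Integrable (fun ω => x 0 ω ^ 2) P)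
    (hxe0 : ∫ ω, x 0 ω * e 0 ω ∂P = 0) (hxx0 : 0 < ∫ ω, x 0 ω ^ 2 ∂P) :
    ∀ᵐ ω ∂P, (∀ᶠ n : ℕ in atTop, ∑ i ∈ Finset.range n, x i ω ^ 2 ≠ 0) ∧
      Tendsto (fun n : ℕ => β - lsSlope n (fun l => x l ω) (fun l => y l ω)) atTop (𝓝 0) := by
  filter_upwards [ae_tendsto_average hiid hid (f := fun p => p.1 * p.2)
      (measurable_fst.mul measurable_snd) hxe,
    ae_tendsto_average hiid hid (f := fun p => p.1 ^ 2)
      (measurable_fst.pow_const 2) hxx] with ω h1 h2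
  have hne : ∀ᶠ n : ℕ in atTop, ∑ i ∈ Finset.range n, x i ω ^ 2 ≠ 0 := by
    filter_upwards [h2.eventually (lt_mem_nhds hxx0)] with n hn hzero
    simp [hzero] at hn
  refine ⟨hne, ?_⟩
  have h3 := (h1.neg).div h2 hxx0.ne'
  rw [hxe0, neg_zero, zero_div] at h3
  refine h3.congr' ?_
  filter_upwards [hne, eventually_ne_atTop 0] with n hn hn0
  rw [sub_lsSlope_eq _ _ _ _ hn]
  have : (n : ℝ) ≠ 0 := by exact_mod_cast hn0
  simp only [Pi.div_apply, ← heq]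
  field_simp

end Model

/-- The witness σ is the sign of `δ n`. The bound C and the gap η do not depend on the indices, so
one threshold for n serves all i, j. -/
theorem eventually_residual_le_iff (S : Finset ℝ) {x e δ : ℕ → ℝ} {C : ℝ} (hx : ∀ i, |x i| ≤ C)
    (he : ∀ i, e i ∈ S) (hδ : Tendsto δ atTop (𝓝 0)) (hδ0 : ∀ᶠ n in atTop, δ n ≠ 0) :
    ∀ᶠ n in atTop, ∃ σ : ℝ, (σ = 1 ∨ σ = -1) ∧ ∀ i j, e j + x j * δ n ≤ e i + x i * δ n ↔
      e j < e i ∨ (e j = e i ∧ σ * x j ≤ σ * x i) := by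
  obtain ⟨η, hη, hgap⟩ := exists_pos_le_sub_of_lt S
  have hlim : Tendsto (fun n => |δ n| * (2 * C)) atTop (𝓝 0) := by
    simpa using hδ.abs.mul_const (2 * C)
  filter_upwards [hδ0, hlim.eventually (gt_mem_nhds hη)] with n hn hsmall
  have key : ∀ σ : ℝ, (∀ i j, x j * δ n ≤ x i * δ n ↔ σ * x j ≤ σ * x i) →
      ∀ i j, e j + x j * δ n ≤ e i + x i * δ n ↔
        e j < e i ∨ (e j = e i ∧ σ * x j ≤ σ * x i) := fun σ hσ i j =>
    add_mul_le_add_mul_iff (hx j) (hx i) (hgap _ (he j) _ (he i)) (hgap _ (he i) _ (he j)) hsmall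
      (hσ i j)
  rcases lt_or_gt_of_ne hn with h | h
  · exact ⟨-1, Or.inr rfl, key _ fun i j => by
      rw [mul_le_mul_right_of_neg h]
      constructor <;> intro <;> linarith⟩
  · exact ⟨1, Or.inl rfl, key _ fun i j => by rw [mul_le_mul_iff_left₀ h, one_mul, one_mul]⟩

theorem IsNearestNeighbourMap.const_mul {n : ℕ} {z : Fin n → ℝ} {M : Fin n → Fin n}
    (hM : IsNearestNeighbourMap z M) (σ : ℝ) : IsNearestNeighbourMap (fun i => σ * z i) M :=
  fun i => ⟨(hM i).1, fun j hj => by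
    simp only [← mul_sub, abs_mul]
    exact mul_le_mul_of_nonneg_left ((hM i).2 j hj) (abs_nonneg σ)⟩

/-! ### The main theorem. -/

/-- `(X, E)` is the population pair and `(x i, y i)`, `i = 0, 1, …`, are i.i.d. copies of `(X, Y)`
with `Y = X β + E`. The map `M n ω` is a nearest neighbour map of `x_0, …, x_{n-1}`; it may depend on
the whole sample point `ω`, so every tie-breaking rule is covered, the uniformly random one included. -/
theorem mainTheorem8
    {Ω : Type*} [MeasurableSpace Ω] (μ : Measure Ω) [IsProbabilityMeasure μ]
    {Ω' : Type*} [MeasurableSpace Ω'] (P : Measure Ω') [IsProbabilityMeasure P]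
    (X E Y : Ω → ℝ) (hX : Measurable X) (hE : Measurable E)
    (hXbdd : ∃ C : ℝ, ∀ᵐ ω ∂μ, |X ω| ≤ C)
    (hXcont : NullSingletonClass (μ.map X))
    (k : ℕ) (hk : 1 < k) (S : Finset ℝ) (hS : S.card = k)
    (hEunif : pdf.IsUniform E (S : Set ℝ) μ Measure.count)
    (hEcentered : ∫ ω, E ω ∂μ = 0)
    (hindep : IndepFun X E μ)
    (β : ℝ) (hβ : β ≠ 0)
    (hY : ∀ ω, Y ω = X ω * β + E ω)
    (x y : ℕ → Ω' → ℝ) (hx : ∀ i, Measurable (x i)) (hy : ∀ i, Measurable (y i))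
    (hiid : iIndepFun (fun (i : ℕ) (ω : Ω') => (x i ω, y i ω)) P)
    (hcopy : ∀ i, IdentDistrib (fun ω => (x i ω, y i ω)) (fun ω => (X ω, Y ω)) P μ)
    (M : (n : ℕ) → Ω' → Fin n → Fin n)
    (hMmeas : ∀ n i, Measurable fun ω => M n ω i)
    (hM : ∀ n, 2 ≤ n → ∀ᵐ ω ∂P, IsNearestNeighbourMap (fun i : Fin n => x i ω) (M n ω)) :
    acT μ E X = 0 ∧
    (∀ i : ℕ, TendstoInMeasure P
      (fun (n : ℕ) (ω : Ω') => lsResidual n (fun l => x l ω) (fun l => y l ω) i) atTop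
      (fun ω => y i ω - x i ω * β)) ∧
    (∀ n : ℕ, Integrable (fun ω =>
      acTn (fun i : Fin n => lsResidual n (fun l => x l ω) (fun l => y l ω) i) (M n ω)) P) ∧
    Tendsto (fun n : ℕ => ∫ ω,
      acTn (fun i : Fin n => lsResidual n (fun l => x l ω) (fun l => y l ω) i) (M n ω) ∂P)
      atTop (𝓝 (1 / (k : ℝ) ^ 2)) ∧
    0 < 1 / (k : ℝ) ^ 2 := by
  classical
  obtain ⟨C, hC⟩ := hXbdd
  have hk0 : k ≠ 0 := by omega
  have hkpos : (0 : ℝ) < k := by exact_mod_cast Nat.pos_of_ne_zero hk0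
  set e : ℕ → Ω' → ℝ := fun i ω => y i ω - x i ω * β
  have he : ∀ i, Measurable (e i) := fun i => (hy i).sub ((hx i).mul_const β)
  have hu : Measurable fun p : ℝ × ℝ => (p.1, p.2 - p.1 * β) := by fun_prop
  have hpair : ∀ i, IdentDistrib (fun ω => (x i ω, e i ω)) (fun ω => (X ω, E ω)) P μ := fun i => by
    have h := (hcopy i).comp hu
    have h2 : (fun p : ℝ × ℝ => (p.1, p.2 - p.1 * β)) ∘ (fun ω => (X ω, Y ω)) =
        fun ω => (X ω, E ω) := by
      ext ω
      · rfl
      · simp [hY]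
    rw [h2] at h
    exact h
  have hiid' : iIndepFun (fun i ω => (x i ω, e i ω)) P :=
    hiid.comp (fun _ p => (p.1, p.2 - p.1 * β)) fun _ => hu
  have hid : ∀ i, IdentDistrib (fun ω => (x i ω, e i ω)) (fun ω => (x 0 ω, e 0 ω)) P P := fun i =>
    (hpair i).trans (hpair 0).symm
  have hxid : ∀ i, IdentDistrib (x i) X P μ := fun i => (hpair i).comp measurable_fst
  have heid : ∀ i, IdentDistrib (e i) E P μ := fun i => (hpair i).comp measurable_snd
  have hind := iIndepFun_uncurry_of_pairs hx he hiid' fun i =>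
    indepFun_of_identDistrib_pair hindep (hpair i).symm
  have hXatom : ∀ a, μ (X ⁻¹' {a}) = 0 := fun a => by
    rw [← Measure.map_apply hX (measurableSet_singleton a)]
    exact hXcont.measure_singleton a
  have hatom : ∀ i a, P (x i ⁻¹' {a}) = 0 := fun i a => by
    rw [(hxid i).measure_mem_eq (measurableSet_singleton a), hXatom]
  have hES : ∀ᵐ ω ∂μ, E ω ∈ S := ae_mem_of_isUniform_count hE hEunif
  have heS : ∀ᵐ ω ∂P, ∀ i, e i ω ∈ S := ae_all_iff.2 fun i =>
    (heid i).symm.ae_snd (p := fun t => t ∈ S) S.measurableSet hES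
  have hxC : ∀ᵐ ω ∂P, ∀ i, |x i ω| ≤ C := ae_all_iff.2 fun i =>
    (hxid i).symm.ae_snd (p := fun t => |t| ≤ C)
      (measurableSet_le measurable_id.abs measurable_const) hC
  have heint : ∀ i (f : ℝ → ℝ), Measurable f → ∫ ω, f (e i ω) ∂P = (∑ s ∈ S, f s) / k :=
    fun i f hf => by
      rw [((heid i).comp hf).integral_eq (f := fun ω => f (e i ω)) (g := fun ω => f (E ω)), ← hS]
      exact integral_comp_of_isUniform_count hE hEunif hf
  have hXint : Integrable X μ := Integrable.of_bound hX.aestronglyMeasurable C hC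
  have hEint : Integrable E μ := by
    refine Integrable.of_bound hE.aestronglyMeasurable (∑ s ∈ S, |s|) ?_
    filter_upwards [hES] with ω hω
    exact Finset.single_le_sum (f := fun s : ℝ => |s|) (fun s _ => abs_nonneg s) hω
  have hXE0 : ∫ ω, X ω * E ω ∂μ = 0 := by
    rw [hindep.integral_fun_mul_eq_mul_integral hXint.1 hEint.1, hEcentered, mul_zero]
  have hXX : Integrable (fun ω => X ω ^ 2) μ := by
    refine Integrable.of_bound (hX.pow_const 2).aestronglyMeasurable (C ^ 2) ?_
    filter_upwards [hC] with ω hω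
    rw [Real.norm_eq_abs, abs_pow]
    exact pow_le_pow_left₀ (abs_nonneg _) hω 2
  have hXX0 : 0 < ∫ ω, X ω ^ 2 ∂μ := by
    refine lt_of_le_of_ne (integral_nonneg fun ω => sq_nonneg _) fun h => ?_
    have hz := (integral_eq_zero_iff_of_nonneg (fun ω => sq_nonneg (X ω)) hXX).1 h.symm
    have hae : ∀ᵐ ω ∂μ, X ω ≠ 0 := by
      rw [ae_iff]
      simp only [not_not]
      exact hXatom 0
    obtain ⟨ω, h1, h2⟩ := (hz.and hae).exists
    exact h2 (by simpa using h1)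
  have hxe_id : IdentDistrib (fun ω => x 0 ω * e 0 ω) (fun ω => X ω * E ω) P μ :=
    (hpair 0).comp (u := fun p : ℝ × ℝ => p.1 * p.2) (by fun_prop)
  have hxx_id : IdentDistrib (fun ω => x 0 ω ^ 2) (fun ω => X ω ^ 2) P μ :=
    (hxid 0).comp (u := fun t => t ^ 2) (measurable_id.pow_const 2)
  have hslope := ae_tendsto_sub_lsSlope (β := β) (fun i ω => rfl) hiid' hid
    (hxe_id.integrable_iff.2 (hindep.integrable_mul hXint hEint)) (hxx_id.integrable_iff.2 hXX)
    (hxe_id.integral_eq.trans hXE0) (hxx_id.integral_eq.symm ▸ hXX0)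
  have hrmeas : ∀ n i, Measurable fun ω => lsResidual n (fun l => x l ω) (fun l => y l ω) i :=
    fun n i => by
      unfold lsResidual lsSlope
      fun_prop
  -- Since k > 1, some nonzero value has positive probability; if all errors vanished, the frequency
  -- of nonzero errors would contradict the strong law.
  have hexne : ∀ᵐ ω ∂P, ∃ i, e i ω ≠ 0 := by
    have hfm : Measurable fun t : ℝ => if t = 0 then (0 : ℝ) else 1 :=
      Measurable.ite (measurableSet_singleton 0) measurable_const measurable_const
    have hlim := ae_tendsto_average hiid' hid
      (f := fun p => if p.2 = 0 then (0 : ℝ) else 1) (hfm.comp measurable_snd)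
      (integrable_of_abs_le (hfm.comp (he 0)) (K := 1) fun ω => by
        split_ifs <;> norm_num)
    filter_upwards [hlim] with ω hω
    by_contra! hzero
    simp only [hzero, if_true, Finset.sum_const_zero, zero_div] at hω
    have hlim0 := tendsto_nhds_unique hω tendsto_const_nhds
    rw [heint 0 _ hfm, div_eq_zero_iff] at hlim0
    have hsum := hlim0.resolve_right hkpos.ne'
    rw [Finset.sum_eq_zero_iff_of_nonneg fun s _ => by split_ifs <;> norm_num] at hsum
    obtain ⟨s, hs, hs0⟩ := Finset.exists_mem_ne (hS.symm ▸ hk) (0 : ℝ)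
    simpa [hs0] using hsum s hs
  have hgood : ∀ᵐ ω ∂P, ∀ᶠ n in atTop, ∃ σ : ℝ, (σ = 1 ∨ σ = -1) ∧ ∀ i j : ℕ,
      lsResidual n (fun l => x l ω) (fun l => y l ω) j ≤
        lsResidual n (fun l => x l ω) (fun l => y l ω) i ↔
      e j ω < e i ω ∨ (e j ω = e i ω ∧ σ * x j ω ≤ σ * x i ω) := by
    filter_upwards [heS, hxC, hslope, hexne,
      ae_all_iff.2 fun n => ae_sum_mul_ne_zero_of_pairs hx he hind hatom n]
      with ω h1 h2 h3 h4 h5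
    obtain ⟨i₀, hi₀⟩ := h4
    have hδ0 : ∀ᶠ n : ℕ in atTop,
        β - lsSlope n (fun l => x l ω) (fun l => y l ω) ≠ 0 := by
      filter_upwards [h3.1, eventually_gt_atTop i₀] with n hn hni
      rw [sub_lsSlope_eq _ _ _ _ hn]
      refine div_ne_zero (neg_ne_zero.2 ?_) hn
      have := h5 n ⟨i₀, hni⟩ hi₀
      rwa [Fin.sum_univ_eq_sum_range (fun j => x j ω * e j ω) n] at this
    filter_upwards [eventually_residual_le_iff S (x := fun i => x i ω) (e := fun i => e i ω)
      h2 h1 h3.2 hδ0] with n hn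
    simpa only [lsResidual_eq _ _ _ β] using hn
  have hinj := fun n => ae_injective_of_pairs hx he hind hatom n
  have hrefl := fun n => ae_ne_reflection_of_pairs hx he hind hatom n
  have hfib : ∀ n, ∀ᵐ ω ∂P, ∀ m : Fin n, (Finset.univ.filter fun i => M n ω i = m).card ≤ 2 := by
    intro n
    rcases Nat.lt_or_ge n 2 with hn | hn
    -- For n < 2 nothing is assumed about M, but there are too few indices to violate the bound.
    · exact ae_of_all _ fun ω m => (Finset.card_filter_le _ _).trans (by simp; omega)
    · filter_upwards [hM n hn, hinj n] with ω h1 h2 m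
      exact h1.card_fiber_le h2 m
  have hTK : ∀ n, ∀ᵐ ω ∂P,
      |acTn (fun i : Fin n => lsResidual n (fun l => x l ω) (fun l => y l ω) i) (M n ω)| ≤ 3 :=
    fun n => (hfib n).mono fun ω hω => abs_acTn_le _ _ hω
  have hTint : ∀ n : ℕ, Integrable (fun ω =>
      acTn (fun i : Fin n => lsResidual n (fun l => x l ω) (fun l => y l ω) i) (M n ω)) P :=
    fun n => Integrable.of_bound (measurable_acTn (fun i : Fin n => hrmeas n i)
      (hMmeas n)).aestronglyMeasurable 3 (hTK n)
  refine ⟨acT_eq_zero_of_indepFun μ hE hX hindep, fun i => ?_, hTint, ?_, by positivity⟩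
  · refine tendstoInMeasure_of_tendsto_ae (fun n => (hrmeas n i).aestronglyMeasurable) ?_
    filter_upwards [hslope] with ω hω
    have := (hω.2.const_mul (x i ω)).const_add (e i ω)
    rw [mul_zero, add_zero] at this
    simpa only [lsResidual_eq _ _ _ β] using this
  · set b : ℕ → ℝ := fun n => 18 * k / √n + 1 / n with hb
    -- The sign is fixed here, because independence of x and the errors would be lost with the
    -- random sign of the slope error. For n < 2 the zero function is a mere filler.
    have hex : ∀ σ : ℝ, σ ≠ 0 → ∀ n : ℕ, ∃ F : Ω' → ℝ, Integrable F P ∧ (∀ᵐ ω ∂P, 0 ≤ F ω) ∧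
        (2 ≤ n → ∀ᵐ ω ∂P, |lexCount (fun i : Fin n => e i ω) (fun i => σ * x i ω) (M n ω) / n ^ 2 -
          (2 * (k : ℝ) ^ 2 + 1) / (6 * k ^ 2)| ≤ F ω) ∧ ∫ ω, F ω ∂P ≤ b n := by
      intro σ hσ n
      rcases Nat.lt_or_ge n 2 with hn | hn
      · refine ⟨0, integrable_zero _ _ _, ae_of_all _ fun ω => le_rfl, fun h => by omega, ?_⟩
        simp only [Pi.zero_apply, integral_zero, hb]
        positivity
      · obtain ⟨F, hF1, hF2, hF3⟩ := exists_integrable_abs_lexCount_sub_le (P := P) (n := n)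
          (by omega) hk0 hS (x := fun i : Fin n => x i) (e := fun i : Fin n => e i) (M := M n)
          (fun i => hx i) (fun i => he i) (hMmeas n) (indepFun_fin_of_pairs hx he hind n)
          (iIndepFun_fin_snd_of_pairs hind n) (heS.mono fun ω h i => h i) (fun i => heint i)
          (hinj n) measurableSet_nearestNeighbourSet
          (by
            filter_upwards [hM n hn, hinj n, hrefl n] with ω h1 h2 h3 i m
            exact h1.eq_iff_mem h2 h3 i m)
          ((hM n hn).mono fun ω h i => (h i).1) (hfib n) hσ
        exact ⟨F, hF1, hF2.mono fun ω h => (abs_nonneg _).trans h, fun _ => hF2, hF3⟩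
    choose F hFint hF0 hFle hFb using hex 1 one_ne_zero
    choose F' hFint' hF0' hFle' hFb' using hex (-1) (by norm_num)
    have hv : 6 * ((2 * (k : ℝ) ^ 2 + 1) / (6 * k ^ 2)) - 2 = 1 / (k : ℝ) ^ 2 := by
      field_simp
      ring
    have hv1 : (2 * (k : ℝ) ^ 2 + 1) / (6 * k ^ 2) ≤ 1 := by
      rw [div_le_one (by positivity)]
      have : (1 : ℝ) ≤ k := by exact_mod_cast hk.le
      nlinarith
    have hG0 : ∀ n, ∀ᵐ ω ∂P, 0 ≤ 8 * (F n ω + F' n ω) + 34 / (n : ℝ) := fun n => by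
      filter_upwards [hF0 n, hF0' n] with ω h1 h2
      positivity
    have hGint : ∀ n : ℕ, Integrable (fun ω => 8 * (F n ω + F' n ω) + 34 / (n : ℝ)) P := fun n =>
      (((hFint n).add (hFint' n)).const_mul 8).add (integrable_const _)
    refine tendsto_integral_of_eventually_abs_sub_le hTint hTK hGint hG0 ?_ ?_
    · have hb0 : Tendsto b atTop (𝓝 0) := by
        have h1 : Tendsto (fun n : ℕ => 18 * (k : ℝ) / √n) atTop (𝓝 0) :=
          tendsto_const_nhds.div_atTop (Real.tendsto_sqrt_atTop.comp tendsto_natCast_atTop_atTop)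
        simpa [hb] using h1.add tendsto_one_div_atTop_nhds_zero_nat
      have hub : Tendsto (fun n : ℕ => 16 * b n + 34 / (n : ℝ)) atTop (𝓝 0) := by
        simpa using (hb0.const_mul 16).add (tendsto_const_div_atTop_nhds_zero_nat 34)
      refine squeeze_zero (fun n => integral_nonneg_of_ae (hG0 n)) (fun n => ?_) hub
      have e1 : ∫ ω, (8 * (F n ω + F' n ω) + 34 / (n : ℝ)) ∂P =
          8 * ((∫ ω, F n ω ∂P) + ∫ ω, F' n ω ∂P) + 34 / n := by
        have hsum : Integrable (fun ω => F n ω + F' n ω) P := (hFint n).add (hFint' n)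
        rw [integral_add (hsum.const_mul 8) (integrable_const _),
          integral_const_mul, integral_add (hFint n) (hFint' n)]
        simp
      rw [e1]
      linarith [hFb n, hFb' n]
    · have hle : ∀ᵐ ω ∂P, ∀ n, 2 ≤ n → (∃ σ : ℝ, (σ = 1 ∨ σ = -1) ∧ ∀ i j : ℕ,
          lsResidual n (fun l => x l ω) (fun l => y l ω) j ≤
            lsResidual n (fun l => x l ω) (fun l => y l ω) i ↔
          e j ω < e i ω ∨ (e j ω = e i ω ∧ σ * x j ω ≤ σ * x i ω)) →
          |acTn (fun i : Fin n => lsResidual n (fun l => x l ω) (fun l => y l ω) i) (M n ω) -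
            1 / (k : ℝ) ^ 2| ≤ 8 * (F n ω + F' n ω) + 34 / (n : ℝ) := by
        refine ae_all_iff.2 fun n => ?_
        by_cases hn : 2 ≤ n
        · filter_upwards [hFle n hn, hFle' n hn, hF0 n, hF0' n, hM n hn, hinj n]
            with ω h1 h2 h3 h4 h5 h6
          rintro - ⟨σ, hσ, hiff⟩
          have hσ0 : σ ≠ 0 := by rcases hσ with rfl | rfl <;> norm_num
          -- Whichever sign occurs at ω, its bound is at most the sum of the two nonnegative bounds.
          have hlex : |lexCount (fun i : Fin n => e i ω) (fun i => σ * x i ω) (M n ω) / n ^ 2 -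
              (2 * (k : ℝ) ^ 2 + 1) / (6 * k ^ 2)| ≤ F n ω + F' n ω := by
            rcases hσ with rfl | rfl
            · linarith
            · linarith
          have := abs_acTn_sub_le hn (e := fun i : Fin n => e i ω)
            (w := fun i : Fin n => σ * x i ω)
            (r := fun i : Fin n => lsResidual n (fun l => x l ω) (fun l => y l ω) i)
            (fun i j hij => h6 (mul_left_cancel₀ hσ0 hij)) (h5.const_mul σ)
            (fun i j => hiff i j) (by positivity) hv1
          rw [hv] at this
          linarith
        · exact ae_of_all _ fun ω h => absurd h hn
      filter_upwards [hle, hgood] with ω h1 h2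
      filter_upwards [h2, eventually_ge_atTop 2] with n hn hn2
      exact h1 n hn2 hn
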